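/- **Theorem.** Let $k\ge 0$ and let $n_1,\dots,n_k$ be positive integers with $n_{i+1}\mid n_i$ for $1\le i\le k-1$. Let $G=\mathbf Z_{n_1}\oplus\cdots\oplus\mathbf Z_{n_k}$, where $\mathbf Z_n=\mathbf Z/n\mathbf Z$ (so $G$ is a finite abelian group), and let $1\to R\to F\to G\to 1$ be any free presentation of $G$, with $F$ a free group. For $c\ge 1$ let $$\mathcal N_cM(G)=\frac{R\cap\gamma_{c+1}(F)}{[R,{}_cF]}$$ be the higher Schur multiplier of $G$ with respect to the variety of nilpotent groups of class at most $c$. Here $\gamma_1(F)=F$, $\gamma_{m+1}(F)=[\gamma_m(F),F]$, and $[R,{}_0F]=R$, $[R,{}_{m+1}F]=[[R,{}_mF],F]$. For $r\ge 0$, choose a strict total order on the formal commutators (bracketings) in letters $x_1<\dots<x_r$ that extends the order of the letters and in which commutators of smaller weight (number of letters, with repetition) precede those of larger weight. The *basic commutators* are defined recursively: each letter is basic, and $[u,v]$ is basic if and only if $u$ and $v$ are basic, $v<u$, and, in case $u=[s,t]$, also $t\le v$. For $c\ge1$ let $b_r$ be the number of basic commutators of weight $c+1$ on $r$ letters. Then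 for every $c\ge 1$, and for every choice of these orders, $b_{i-1}\le b_i$ for $3\le i\le k$, and $$\mathcal N_cM(G)\;\cong\;\mathbf Z_{n_2}^{(b_2)}\oplus\mathbf Z_{n_3}^{(b_3-b_2)}\oplus\cdots\oplus\mathbf Z_{n_k}^{(b_k-b_{k-1})},$$ where $\mathbf Z_n^{(m)}$ denotes the direct sum of $m$ copies of $\mathbf Z_n$. (For $k\le 1$ the right-hand side is trivial.) -/

import Mathlib

/-- The iterated commutator subgroup `[R, F, …, F]` with `c` factors `F`, i.e. `[R, _c F]`:
`[R, _0 F] = R` and `[R, _{c+1} F] = [[R, _c F], F]`. -/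
def iteratedCommutator {F : Type*} [Group F] (R : Subgroup F) : ℕ → Subgroup F
  | 0 => R
  | c + 1 => ⁅iteratedCommutator R c, (⊤ : Subgroup F)⁆

instance iteratedCommutator_normal {F : Type*} [Group F] (R : Subgroup F) [hR : R.Normal]
    (c : ℕ) : (iteratedCommutator R c).Normal := by
  induction c with
  | zero => exact hR
  | succ c ih =>
    have := ih
    exact Subgroup.commutator_normal _ _

/-- `[R, _c F]` is contained in `R ∩ γ_{c+1}(F)`, so the quotient below is the intended one. -/
theorem iteratedCommutator_le {F : Type*} [Group F] (R : Subgroup F) [hR : R.Normal] (c : ℕ) :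
    iteratedCommutator R c ≤ R ⊓ (⊤ : Subgroup F).lowerCentralSeries c := by
  induction c with
  | zero => exact le_inf le_rfl le_top
  | succ c ih =>
    refine le_inf ?_ (Subgroup.commutator_mono (ih.trans inf_le_right) le_rfl)
    exact (Subgroup.commutator_mono (ih.trans inf_le_left) le_rfl).trans
      (Subgroup.commutator_le_left R ⊤)

/-- The higher Schur multiplier `(R ∩ γ_{c+1}(F)) / [R, _c F]`, with respect to the variety of
nilpotent groups of class at most `c`, computed from the presentation `1 → R → F → F / R → 1`.
Mathlib's lower central series starts at index `0`, so that its term of index `c` is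
`γ_{c+1}(F)`. -/
abbrev HigherSchurMultiplier {F : Type*} [Group F] (R : Subgroup F) (c : ℕ) : Type _ :=
  ↥(R ⊓ (⊤ : Subgroup F).lowerCentralSeries c) ⧸
    (iteratedCommutator R c).subgroupOf (R ⊓ (⊤ : Subgroup F).lowerCentralSeries c)

/-- An ordering of the formal commutators on the letters `x_0 < x_1 < … < x_{r-1}`, as used to
define basic commutators: a strict total order that extends the order of the letters and in which
a commutator of smaller weight precedes one of larger weight; commutators of the same weight
(at least 2) are ordered arbitrarily. A formal commutator is an element of the free magma,
`u * v` standing for `[u, v]`, and its weight is its length. -/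
structure CommutatorOrder (r : ℕ) where
  lt : FreeMagma (Fin r) → FreeMagma (Fin r) → Prop
  strictTotal : IsStrictTotalOrder (FreeMagma (Fin r)) lt
  letters : ∀ i j : Fin r, i < j → lt (FreeMagma.of i) (FreeMagma.of j)
  weight : ∀ u v : FreeMagma (Fin r), u.length < v.length → lt u v

/-- Such orderings exist. -/
instance (r : ℕ) : Nonempty (CommutatorOrder r) := by
  classical
  let idx : FreeMagma (Fin r) → ℕ := fun t =>
    FreeMagma.recOnMul (C := fun _ => ℕ) t (fun i => (i : ℕ)) (fun _ _ _ _ => 0)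
  let : LinearOrder (FreeMagma (Fin r)) := linearOrderOfSTO WellOrderingRel
  let key : FreeMagma (Fin r) → ℕ ×ₗ (ℕ ×ₗ FreeMagma (Fin r)) :=
    fun t => toLex (t.length, toLex (idx t, t))
  have hinj : Function.Injective key := fun s t h => by
    have := congrArg (fun p => (ofLex (ofLex p).2).2) h
    exact this
  refine ⟨⟨fun s t => key s < key t, ?_, ?_, ?_⟩⟩
  · exact (RelEmbedding.preimage ⟨key, hinj⟩ (· < ·)).isStrictTotalOrder
  · intro i j h
    refine Prod.Lex.right _ (Prod.Lex.left _ _ ?_)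
    exact h
  · intro u v h
    exact Prod.Lex.left _ _ h

/-- Basic commutators: every letter is basic; `[u, v]` is basic when `u` and `v` are basic,
`v < u`, and, if `u = [s, t]`, moreover `t ≤ v`. -/
inductive IsBasicCommutator {r : ℕ} (o : CommutatorOrder r) : FreeMagma (Fin r) → Prop
  | letter (i : Fin r) : IsBasicCommutator o (FreeMagma.of i)
  | bracket (u v : FreeMagma (Fin r)) (hu : IsBasicCommutator o u) (hv : IsBasicCommutator o v)
      (hlt : o.lt v u) (hle : ∀ s t : FreeMagma (Fin r), u = s * t → t = v ∨ o.lt t v) :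
      IsBasicCommutator o (u * v)

/-- There are finitely many formal commutators of bounded weight on `r` letters, so that the count
below is a genuine cardinality. -/
theorem formalCommutators_finite (r n : ℕ) : {t : FreeMagma (Fin r) | t.length ≤ n}.Finite := by
  induction n with
  | zero =>
    refine Set.Finite.subset Set.finite_empty ?_
    intro t ht
    have := t.length_pos
    simp at ht; omega
  | succ n ih =>
    refine ((Set.finite_range FreeMagma.of).union (Set.Finite.image2 (· * ·) ih ih)).subset ?_
    intro t ht
    cases t with
    | of i => exact Or.inl ⟨i, rfl⟩
    | mul u v =>
      have h1 := u.length_pos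
      have h2 := v.length_pos
      have h3 : u.length + v.length ≤ n + 1 := ht
      exact Or.inr ⟨u, by simp; omega, v, by simp; omega, rfl⟩

/-- The number of basic commutators of weight `w` on `r` letters. -/
noncomputable def basicCommutatorCount {r : ℕ} (o : CommutatorOrder r) (w : ℕ) : ℕ :=
  Set.ncard {t : FreeMagma (Fin r) | IsBasicCommutator o t ∧ t.length = w}

/-!
The group `G = ⨁ ZMod (n i)` is abelian, so `R` contains the commutator subgroup, and the
multiplier is `γ_{c+1}(F) / [R, _c F]`, a quotient of `γ_{c+1}(F) / γ_{c+2}(F)`: it is the component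
of degree `c + 1` of the free Lie ring on the abelian group `G`. Being independent of the
presentation (`HigherSchurMultiplier.nonempty_mulEquiv`), it may be computed for the free group on
`x_1, …, x_k`, with `x_i` sent to the generator of the `i`-th summand.

There it is generated by the basic commutators of weight `c + 1`
(`lowerCentralSeries_le_basicSpan`), and by multilinearity a commutator `t` whose largest letter is
`x_i` is annihilated by `n i` (`bracketEval_pow_mem`). There are no further relations: for every
`i`, sending `x_j` to `1 + x_j X` for `j ≤ i` and to `1` for `j > i` defines a homomorphism to the
units of the power series over the free associative algebra on `ZMod (n i)`, whose leading
coefficient on `γ_{c+1}(F)` kills `[R, _c F]`, as `n i` divides `n j` for `j ≤ i`. It sends the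
basic commutators in the first `i` letters to the corresponding Lie polynomials and the others to zero.
These polynomials are independent over any commutative ring (`linearIndependent_bracketEval`), so
in a relation the coefficients of the commutators with largest letter `x_i` are divisible by `n i`.
Hence the multiplier is the product of the groups `ZMod (n i)`, one for each basic commutator of
weight `c + 1` with largest letter `x_i`.

Independence is a count: the products of nondecreasing sequences of basic commutators span the free
associative algebra (`prod_mem_standardSpan`), such a sequence can be recovered from the word that
remains when its brackets are forgotten (`standardFactorization_flatMap_foliage`), so that there
are no more of them than words, and a surjective endomorphism of a finitely generated module over a
commutative ring is injective. The same independence shows that the number of basic commutators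
is a dimension, hence the same for all orders (`basicCommutatorCount_eq_finrank`), so that
`b_i - b_{i-1}` of them have largest letter `x_i` (`ncard_maxLetter_eq`); for `i = 1` there are
none.
-/

open scoped commutatorElement

/-! ### Iterated commutator subgroups and change of presentation -/

/-- The three subgroups lemma modulo a normal subgroup. -/
theorem Subgroup.commutator_commutator_le_of_rotate {G : Type*} [Group G]
    {H₁ H₂ H₃ N : Subgroup G} [N.Normal] (h1 : ⁅⁅H₂, H₃⁆, H₁⁆ ≤ N) (h2 : ⁅⁅H₃, H₁⁆, H₂⁆ ≤ N) :
    ⁅⁅H₁, H₂⁆, H₃⁆ ≤ N := by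
  have key (K : Subgroup G) : K ≤ N ↔ K.map (QuotientGroup.mk' N) = ⊥ := by
    rw [Subgroup.map_eq_bot_iff, QuotientGroup.ker_mk']
  rw [key] at h1 h2 ⊢
  simp only [Subgroup.map_commutator] at h1 h2 ⊢
  exact Subgroup.commutator_commutator_eq_bot_of_rotate h1 h2

theorem lowerCentralSeries_commutator_iteratedCommutator_le {G : Type*} [Group G]
    (R : Subgroup G) [R.Normal] (m j : ℕ) :
    ⁅(⊤ : Subgroup G).lowerCentralSeries m, iteratedCommutator R j⁆ ≤
      iteratedCommutator R (j + m + 1) := by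
  induction m generalizing j with
  | zero => exact Subgroup.commutator_comm_le _ _
  | succ m ih =>
    rw [Subgroup.lowerCentralSeries_succ]
    apply Subgroup.commutator_commutator_le_of_rotate
    · rw [Subgroup.commutator_comm ⊤, Subgroup.commutator_comm]
      have := ih (j + 1)
      rwa [show j + 1 + m + 1 = j + (m + 1) + 1 by omega] at this
    · refine Subgroup.commutator_mono ?_ le_rfl
      rw [Subgroup.commutator_comm]
      exact ih j

theorem iteratedCommutator_top {G : Type*} [Group G] (m : ℕ) :
    iteratedCommutator (⊤ : Subgroup G) m = (⊤ : Subgroup G).lowerCentralSeries m := by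
  induction m with
  | zero => rfl
  | succ m ih => rw [Subgroup.lowerCentralSeries_succ, ← ih, iteratedCommutator]

theorem lowerCentralSeries_commutator_le {G : Type*} [Group G] (m n : ℕ) :
    ⁅(⊤ : Subgroup G).lowerCentralSeries m, (⊤ : Subgroup G).lowerCentralSeries n⁆ ≤
      (⊤ : Subgroup G).lowerCentralSeries (m + n + 1) := by
  have := lowerCentralSeries_commutator_iteratedCommutator_le (⊤ : Subgroup G) m n
  rwa [iteratedCommutator_top, iteratedCommutator_top, add_comm n] at this

theorem lowerCentralSeries_le_iteratedCommutator {G : Type*} [Group G] (R : Subgroup G)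
    (hR : _root_.commutator G ≤ R) (m : ℕ) :
    (⊤ : Subgroup G).lowerCentralSeries (m + 1) ≤ iteratedCommutator R m := by
  induction m with
  | zero => rwa [Subgroup.top_lowerCentralSeries_one]
  | succ m ih => exact Subgroup.commutator_mono ih le_rfl

theorem iteratedCommutator_map_le {G H : Type*} [Group G] [Group H] (f : G →* H)
    {R : Subgroup G} {S : Subgroup H} (h : R ≤ S.comap f) (m : ℕ) :
    iteratedCommutator R m ≤ (iteratedCommutator S m).comap f := by
  rw [← Subgroup.map_le_iff_le_comap] at h ⊢
  induction m with
  | zero => exact h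
  | succ m ih =>
    rw [iteratedCommutator, Subgroup.map_commutator]
    exact Subgroup.commutator_mono ih le_top

/-- An endomorphism that is the identity modulo `R` moves the elements of `γ_{m+1}` only by
elements of `[R, _m G]`. -/
theorem map_mul_inv_mem_iteratedCommutator {G : Type*} [Group G] (R : Subgroup G) [R.Normal]
    (h : G →* G) (hh : ∀ x, h x * x⁻¹ ∈ R) (m : ℕ) :
    ∀ x ∈ (⊤ : Subgroup G).lowerCentralSeries m, h x * x⁻¹ ∈ iteratedCommutator R m := by
  induction m with
  | zero => exact fun x _ => hh x
  | succ m ih =>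
    set N := iteratedCommutator R (m + 1) with hN
    have hcomm {a b : G} (hab : ⁅a, b⁆ ∈ N) : (a : G ⧸ N) * b = b * a := by
      rw [← commutatorElement_eq_one_iff_mul_comm]
      exact (QuotientGroup.eq_one_iff _).2 hab
    have key : (⊤ : Subgroup G).lowerCentralSeries (m + 1) ≤
        ((QuotientGroup.mk' N).comp h).eqLocus (QuotientGroup.mk' N) := by
      rw [Subgroup.lowerCentralSeries_succ, Subgroup.commutator_le]
      intro x hx y _
      obtain ⟨s, hs, hsx⟩ : ∃ s ∈ iteratedCommutator R m, h x = s * x := ⟨_, ih x hx, by simp⟩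
      obtain ⟨r, hr, hry⟩ : ∃ r ∈ R, h y = r * y := ⟨_, hh y, by simp⟩
      change (QuotientGroup.mk' N) (h ⁅x, y⁆) = QuotientGroup.mk' N ⁅x, y⁆
      have hsc (z : G) : Commute (s : G ⧸ N) z :=
        hcomm (Subgroup.commutator_mem_commutator hs (Subgroup.mem_top z))
      have hr' {j : ℕ} {z : G} (hz : z ∈ (⊤ : Subgroup G).lowerCentralSeries j) :
          ⁅z, r⁆ ∈ iteratedCommutator R (0 + j + 1) :=
        lowerCentralSeries_commutator_iteratedCommutator_le R j 0
          (Subgroup.commutator_mem_commutator hz hr)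
      have hxr : Commute (x : G ⧸ N) r := hcomm (by simpa [hN] using hr' hx)
      have hxyr : Commute ((⁅x, y⁆ : G) : G ⧸ N) r := by
        have h1 := hr' (j := m + 1)
          (Subgroup.commutator_mem_commutator hx (Subgroup.mem_top y))
        rw [zero_add] at h1
        exact hcomm (Subgroup.commutator_le_left _ _ h1)
      rw [map_commutatorElement h, hsx, hry, commutatorElement_mul_left_eq_conj_mul,
        commutatorElement_mul_right_eq_mul_conj x r y]
      have e1 : QuotientGroup.mk' N ⁅s, r * y⁆ = 1 := by
        rw [map_commutatorElement]; exact (hsc _).commutator_eq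
      have e2 : QuotientGroup.mk' N ⁅x, r⁆ = 1 := by
        rw [map_commutatorElement]; exact hxr.commutator_eq
      simp only [map_mul, map_inv, e1, e2, one_mul, mul_one]
      have e3 : Commute (QuotientGroup.mk' N s) (QuotientGroup.mk' N (r * ⁅x, y⁆ * r⁻¹)) :=
        hsc (r * ⁅x, y⁆ * r⁻¹)
      simp only [map_mul, map_inv] at e3
      rw [e3.eq, mul_inv_cancel_right]
      have e4 : Commute (QuotientGroup.mk' N ⁅x, y⁆) (QuotientGroup.mk' N r) := hxyr
      rw [← e4.eq, mul_inv_cancel_right]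
    intro x hx
    have h1 : (h x : G ⧸ N) = x := key hx
    refine (QuotientGroup.eq_one_iff _).1 ?_
    rw [QuotientGroup.mk_mul, h1, QuotientGroup.mk_inv, mul_inv_cancel]

/-- The map of higher Schur multipliers induced by a morphism of presentations. -/
def HigherSchurMultiplier.map {F₁ F₂ : Type*} [Group F₁] [Group F₂] {R₁ : Subgroup F₁}
    {R₂ : Subgroup F₂} [R₁.Normal] [R₂.Normal] (f : F₁ →* F₂) (hf : R₁ ≤ R₂.comap f) (c : ℕ) :
    HigherSchurMultiplier R₁ c →* HigherSchurMultiplier R₂ c :=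
  have h (x : ↥(R₁ ⊓ (⊤ : Subgroup F₁).lowerCentralSeries c)) :
      f x ∈ R₂ ⊓ (⊤ : Subgroup F₂).lowerCentralSeries c := by
    refine ⟨hf x.2.1, ?_⟩
    have h1 := iteratedCommutator_map_le f (R := ⊤) (S := ⊤) le_top c
    rw [iteratedCommutator_top, iteratedCommutator_top] at h1
    exact h1 x.2.2
  QuotientGroup.map _ _ ((f.comp (Subgroup.subtype _)).codRestrict _ h)
    (fun _ hx => iteratedCommutator_map_le f hf c hx)

/-- The higher Schur multiplier does not depend on the free presentation. -/
theorem HigherSchurMultiplier.nonempty_mulEquiv {F₁ F₂ G : Type*} [Group F₁] [Group F₂] [Group G]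
    [IsFreeGroup F₁] [IsFreeGroup F₂] (π₁ : F₁ →* G) (π₂ : F₂ →* G)
    (h₁ : Function.Surjective π₁) (h₂ : Function.Surjective π₂) (c : ℕ) :
    Nonempty (HigherSchurMultiplier π₁.ker c ≃* HigherSchurMultiplier π₂.ker c) := by
  obtain ⟨f, hf⟩ : ∃ f : F₁ →* F₂, ∀ x, π₂ (f x) = π₁ x := by
    choose s hs using h₂
    refine ⟨IsFreeGroup.lift (fun a => s (π₁ (IsFreeGroup.of a))), fun x => ?_⟩
    refine DFunLike.congr_fun (f := π₂.comp _) (IsFreeGroup.ext_hom fun a => ?_) x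
    simp [hs]
  obtain ⟨g, hg⟩ : ∃ g : F₂ →* F₁, ∀ x, π₁ (g x) = π₂ x := by
    choose s hs using h₁
    refine ⟨IsFreeGroup.lift (fun a => s (π₂ (IsFreeGroup.of a))), fun x => ?_⟩
    refine DFunLike.congr_fun (f := π₁.comp _) (IsFreeGroup.ext_hom fun a => ?_) x
    simp [hs]
  have hf' : π₁.ker ≤ π₂.ker.comap f := fun x hx => by simpa [MonoidHom.mem_ker, hf] using hx
  have hg' : π₂.ker ≤ π₁.ker.comap g := fun x hx => by simpa [MonoidHom.mem_ker, hg] using hx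
  refine ⟨MonoidHom.toMulEquiv (HigherSchurMultiplier.map f hf' c)
    (HigherSchurMultiplier.map g hg' c) ?_ ?_⟩
  · refine QuotientGroup.monoidHom_ext _ (MonoidHom.ext fun x => ?_)
    refine (QuotientGroup.eq_iff_div_mem).2 ?_
    rw [Subgroup.mem_subgroupOf, div_eq_mul_inv]
    refine map_mul_inv_mem_iteratedCommutator π₁.ker (g.comp f) (fun y => ?_) c x x.2.2
    simp [MonoidHom.mem_ker, hf, hg]
  · refine QuotientGroup.monoidHom_ext _ (MonoidHom.ext fun x => ?_)
    refine (QuotientGroup.eq_iff_div_mem).2 ?_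
    rw [Subgroup.mem_subgroupOf, div_eq_mul_inv]
    refine map_mul_inv_mem_iteratedCommutator π₂.ker (f.comp g) (fun y => ?_) c x x.2.2
    simp [MonoidHom.mem_ker, hf, hg]

/-! ### Basic commutators span -/

/-- The value of a formal commutator at the letters `x`, its brackets being read as those of `E`. -/
def bracketEval {r : ℕ} {E : Type*} [Bracket E E] (x : Fin r → E) : FreeMagma (Fin r) → E
  | .of i => x i
  | .mul u v => ⁅bracketEval x u, bracketEval x v⁆

theorem bracketEval_of {r : ℕ} {E : Type*} [Bracket E E] (x : Fin r → E) (i : Fin r) :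
    bracketEval x (FreeMagma.of i) = x i := rfl

theorem bracketEval_mul {r : ℕ} {E : Type*} [Bracket E E] (x : Fin r → E)
    (u v : FreeMagma (Fin r)) :
    bracketEval x (u * v) = ⁅bracketEval x u, bracketEval x v⁆ := rfl

namespace CommutatorOrder

variable {r : ℕ} (o : CommutatorOrder r)

theorem trans {u v w : FreeMagma (Fin r)} (h₁ : o.lt u v) (h₂ : o.lt v w) : o.lt u w :=
  have := o.strictTotal
  _root_.trans h₁ h₂

theorem irrefl (u : FreeMagma (Fin r)) : ¬ o.lt u u :=
  have := o.strictTotal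
  _root_.irrefl u

theorem trichotomy (u v : FreeMagma (Fin r)) : o.lt u v ∨ u = v ∨ o.lt v u :=
  have := o.strictTotal
  trichotomous_of o.lt u v

theorem not_lt {u v : FreeMagma (Fin r)} : ¬ o.lt u v ↔ v = u ∨ o.lt v u := by
  constructor
  · intro h
    rcases o.trichotomy u v with h' | h' | h'
    exacts [absurd h' h, Or.inl h'.symm, Or.inr h']
  · rintro (rfl | h) h'
    exacts [o.irrefl _ h', o.irrefl _ (o.trans h h')]

theorem lt_mul_right (u v : FreeMagma (Fin r)) : o.lt v (u * v) :=
  o.weight _ _ (Nat.lt_add_of_pos_left u.length_pos)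

end CommutatorOrder

section Span

variable {r : ℕ} (o : CommutatorOrder r) {E : Type*} [Bracket E E] (x : Fin r → E) (sp : ℕ → Set E)

/-- The hypotheses under which brackets of basic commutators are combinations of basic
commutators: `sp n` plays the role of the set of combinations of the basic commutators of
weight `n`, possibly up to terms that are to be neglected. Only what the collection process
uses is recorded: linearity on the left, antisymmetry and the Jacobi identity, each as an
implication between memberships. -/
structure IsCollecting : Prop where
  basic_mem : ∀ t, IsBasicCommutator o t → bracketEval x t ∈ sp t.length
  linear : ∀ m n v, 0 < m → 0 < n → v ∈ sp n →
    (∀ h, IsBasicCommutator o h → h.length = m → ⁅bracketEval x h, v⁆ ∈ sp (m + n)) →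
    ∀ a ∈ sp m, ⁅a, v⁆ ∈ sp (m + n)
  self_mem : ∀ n (a : E), ⁅a, a⁆ ∈ sp n
  anti : ∀ n (a b : E), ⁅a, b⁆ ∈ sp n → ⁅b, a⁆ ∈ sp n
  jacobi : ∀ i j k a b c, 0 < i → 0 < j → 0 < k → a ∈ sp i → b ∈ sp j → c ∈ sp k →
    ⁅⁅a, c⁆, b⁆ ∈ sp (i + j + k) → ⁅a, ⁅b, c⁆⁆ ∈ sp (i + j + k) → ⁅⁅a, b⁆, c⁆ ∈ sp (i + j + k)

variable {o x sp}

/-- The collection step: the bracket of two basic commutators is a combination of basic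
commutators. If `u = [s, t]` with `t > v`, the Jacobi identity rewrites `[u, v]` through
`[[s, v], t]` and `[s, [t, v]]`, where both entries of the outer bracket exceed `v`; so the
induction is on the weight and, for a given weight, downwards on the smaller entry. -/
theorem IsCollecting.bracket_basic_mem (H : IsCollecting o x sp) (n : ℕ) :
    ∀ u v, IsBasicCommutator o u → IsBasicCommutator o v → u.length + v.length = n →
      ⁅bracketEval x u, bracketEval x v⁆ ∈ sp n := by
  induction n using Nat.strong_induction_on with
  | _ n ih =>
  have main (N : ℕ) : ∀ u v, IsBasicCommutator o u → IsBasicCommutator o v →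
      u.length + v.length = n → o.lt v u →
      {t : FreeMagma (Fin r) | t.length ≤ n ∧ o.lt v t}.ncard = N →
      ⁅bracketEval x u, bracketEval x v⁆ ∈ sp n := by
    induction N using Nat.strong_induction_on with
    | _ N ihN =>
    intro u v hu hv hlen hlt hN
    have inner (p q : FreeMagma (Fin r)) (hp : IsBasicCommutator o p) (hq : IsBasicCommutator o q)
        (hpq : p.length + q.length = n) (hvp : o.lt v p) (hvq : o.lt v q) :
        ⁅bracketEval x p, bracketEval x q⁆ ∈ sp n := by
      have hcard (w : FreeMagma (Fin r)) (hw : w.length ≤ n) (hvw : o.lt v w) :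
          {t : FreeMagma (Fin r) | t.length ≤ n ∧ o.lt w t}.ncard < N := by
        rw [← hN]
        refine Set.ncard_lt_ncard ?_ ((formalCommutators_finite r n).subset fun t ht => ht.1)
        refine ⟨fun t ht => ⟨ht.1, o.trans hvw ht.2⟩, fun h => ?_⟩
        exact o.irrefl w (h (show w ∈ _ from ⟨hw, hvw⟩)).2
      rcases o.trichotomy p q with h | h | h
      · exact H.anti _ _ _ (ihN _ (hcard p (by omega) hvp) q p hq hp (by omega) h rfl)
      · subst h
        exact H.self_mem _ _
      · exact ihN _ (hcard q (by omega) hvq) p q hp hq hpq h rfl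
    have hmem := H.basic_mem
    cases hu with
    | letter i =>
      rw [← bracketEval_mul, ← hlen]
      refine hmem _ (.bracket _ _ (.letter i) hv hlt fun s t h => ?_)
      cases h
    | bracket s t hs ht hts hle =>
      by_cases htv : t = v ∨ o.lt t v
      · rw [← bracketEval_mul, ← hlen]
        refine hmem _ (.bracket _ _ (.bracket s t hs ht hts hle) hv hlt fun s' t' h => ?_)
        cases h
        exact htv
      · have hvt : o.lt v t := by
          rcases o.trichotomy t v with h | h | h
          exacts [absurd (Or.inr h) htv, absurd (Or.inl h) htv, h]
        have hvs := o.trans hvt hts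
        have hl : s.length + t.length + v.length = n := hlen
        have p1 := s.length_pos
        have p2 := t.length_pos
        have p3 := v.length_pos
        rw [bracketEval_mul]
        have e1 := ih (s.length + v.length) (by omega) s v hs hv rfl
        have e2 := ih (t.length + v.length) (by omega) t v ht hv rfl
        have hjac := H.jacobi _ _ _ _ _ _ p1 p2 p3 (hmem s hs) (hmem t ht) (hmem v hv)
        rw [hl] at hjac
        apply hjac
        · have := H.linear (s.length + v.length) t.length _ (by omega) p2 (hmem t ht)
            (fun h hh hhl => ?_) _ e1
          · rwa [show s.length + v.length + t.length = n by omega] at this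
          · rw [show s.length + v.length + t.length = n by omega]
            exact inner h t hh ht (by omega) (o.weight _ _ (by omega)) hvt
        · apply H.anti
          have := H.linear (t.length + v.length) s.length _ (by omega) p1 (hmem s hs)
            (fun h hh hhl => ?_) _ e2
          · rwa [show t.length + v.length + s.length = n by omega] at this
          · rw [show t.length + v.length + s.length = n by omega]
            exact inner h s hh hs (by omega) (o.weight _ _ (by omega)) hvs
  intro u v hu hv hlen
  rcases o.trichotomy u v with h | h | h
  · exact H.anti _ _ _ (main _ v u hv hu (by omega) h rfl)
  · subst h
    exact H.self_mem _ _
  · exact main _ u v hu hv hlen h rfl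

theorem IsCollecting.bracket_mem (H : IsCollecting o x sp) {m n : ℕ} (hm : 0 < m) (hn : 0 < n)
    {a b : E} (ha : a ∈ sp m) (hb : b ∈ sp n) : ⁅a, b⁆ ∈ sp (m + n) := by
  refine H.linear m n b hm hn hb (fun h hh hhl => H.anti _ _ _ ?_) a ha
  have := H.linear n m (bracketEval x h) hn hm (hhl ▸ H.basic_mem h hh) (fun g hg hgl => ?_) b hb
  · rwa [add_comm] at this
  · exact H.bracket_basic_mem _ g h hg hh (by omega)

theorem IsCollecting.bracketEval_mem (H : IsCollecting o x sp) (t : FreeMagma (Fin r)) :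
    bracketEval x t ∈ sp t.length := by
  induction t with
  | ih1 i => exact H.basic_mem _ (.letter i)
  | ih2 u v hu hv => exact H.bracket_mem u.length_pos v.length_pos hu hv

end Span

/-! ### Generation of the lower central factors of a group by basic commutators -/

section LowerCentral

variable {G : Type*} [Group G]

local notation "γ" => Subgroup.lowerCentralSeries (⊤ : Subgroup G)

theorem commutatorElement_mem_lowerCentralSeries {m n : ℕ} {a b : G} (ha : a ∈ γ m)
    (hb : b ∈ γ n) : ⁅a, b⁆ ∈ γ (m + n + 1) :=
  lowerCentralSeries_commutator_le m n (Subgroup.commutator_mem_commutator ha hb)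

theorem mem_lowerCentralSeries_of_le {m n : ℕ} (h : n ≤ m) {a : G} (ha : a ∈ γ m) : a ∈ γ n :=
  Subgroup.lowerCentralSeries_antitone _ h ha

/-- The elements `a` of a term of the lower central series whose bracket with a given `v` lies in
`C`, a subgroup containing the next term after the one in which these brackets lie. -/
def bracketPreimage (m n : ℕ) (v : G) (hv : v ∈ γ n) (C : Subgroup G) (hC : γ (m + n + 2) ≤ C) :
    Subgroup G where
  carrier := {a | a ∈ γ m ∧ ⁅a, v⁆ ∈ C}
  one_mem' := ⟨one_mem _, by simp [one_mem]⟩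
  mul_mem' := by
    rintro a b ⟨ha, ha'⟩ ⟨hb, hb'⟩
    refine ⟨mul_mem ha hb, ?_⟩
    have e : ⁅a * b, v⁆ = ⁅a, ⁅b, v⁆⁆ * ⁅b, v⁆ * ⁅a, v⁆ := by
      simp [commutatorElement_def, mul_assoc]
    rw [e]
    refine mul_mem (mul_mem (hC (mem_lowerCentralSeries_of_le ?_
      (commutatorElement_mem_lowerCentralSeries ha
        (commutatorElement_mem_lowerCentralSeries hb hv)))) hb') ha'
    omega
  inv_mem' := by
    rintro a ⟨ha, ha'⟩
    refine ⟨inv_mem ha, ?_⟩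
    have e : ⁅a⁻¹, v⁆ = ⁅a⁻¹, ⁅v, a⁆⁆ * ⁅a, v⁆⁻¹ := by
      simp [commutatorElement_def, mul_assoc]
    rw [e]
    refine mul_mem (hC (mem_lowerCentralSeries_of_le ?_
      (commutatorElement_mem_lowerCentralSeries (inv_mem ha)
        (commutatorElement_mem_lowerCentralSeries hv ha)))) (inv_mem ha')
    omega

/-- The Jacobi identity for group commutators, modulo deeper terms of the lower central series. -/
theorem commutatorElement_jacobi_mem {i j k : ℕ} {a b c : G} (ha : a ∈ γ i) (hb : b ∈ γ j)
    (hc : c ∈ γ k) {C : Subgroup G} (hC : γ (i + j + k + 3) ≤ C) (h₁ : ⁅⁅a, c⁆, b⁆ ∈ C)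
    (h₂ : ⁅a, ⁅b, c⁆⁆ ∈ C) : ⁅⁅a, b⁆, c⁆ ∈ C := by
  have conj_mem_iff {l m n : ℕ} (h : i + j + k = l + m + n) {p q s : G} (hp : p ∈ γ l)
      (hq : q ∈ γ m) (hs : s ∈ γ n) : ⁅⁅p, q⁆, q * s * q⁻¹⁆ ∈ C ↔ ⁅⁅p, q⁆, s⁆ ∈ C := by
    have hpq := commutatorElement_mem_lowerCentralSeries hp hq
    have hqs := commutatorElement_mem_lowerCentralSeries hq hs
    have e : ⁅⁅p, q⁆, q * s * q⁻¹⁆ = ⁅⁅p, q⁆, ⁅q, s⁆⁆ * ⁅⁅q, s⁆, ⁅⁅p, q⁆, s⁆⁆ * ⁅⁅p, q⁆, s⁆ := by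
      simp [commutatorElement_def, mul_assoc]
    rw [e]
    refine Subgroup.mul_mem_cancel_left _ (mul_mem ?_ ?_)
    · refine hC (mem_lowerCentralSeries_of_le ?_
        (commutatorElement_mem_lowerCentralSeries hpq hqs))
      omega
    · refine hC (mem_lowerCentralSeries_of_le ?_ (commutatorElement_mem_lowerCentralSeries hqs
        (commutatorElement_mem_lowerCentralSeries hpq hs)))
      omega
  have hw := commutatorElement_commutatorElement_conj_mul a b c
  have h2 : ⁅⁅b, c⁆, a⁆ ∈ C := by
    rw [← commutatorElement_inv]
    exact inv_mem h₂
  have h3 : ⁅⁅c, a⁆, b⁆ ∈ C := by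
    rw [← commutatorElement_inv a c]
    refine ((bracketPreimage (i + k + 1) j b hb C ?_).inv_mem
      ⟨commutatorElement_mem_lowerCentralSeries ha hc, h₁⟩).2
    rwa [show i + k + 1 + j + 2 = i + j + k + 3 by omega]
  rw [← conj_mem_iff (by omega) hb hc ha] at h2
  rw [← conj_mem_iff (by omega) hc ha hb] at h3
  rw [← conj_mem_iff rfl ha hb hc]
  rw [mul_assoc] at hw
  rw [eq_inv_of_mul_eq_one_left hw]
  exact inv_mem (mul_mem h2 h3)

variable {r : ℕ} (o : CommutatorOrder r) (x : Fin r → G)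

theorem bracketEval_mem_lowerCentralSeries (t : FreeMagma (Fin r)) :
    bracketEval x t ∈ γ (t.length - 1) := by
  induction t with
  | ih1 i => exact Subgroup.mem_top _
  | ih2 u v hu hv =>
    have h := commutatorElement_mem_lowerCentralSeries hu hv
    have h1 := u.length_pos
    have h2 := v.length_pos
    rwa [show u.length - 1 + (v.length - 1) + 1 = (u * v).length - 1 by
      change _ = u.length + v.length - 1; omega] at h

/-- The subgroup generated by the values of the basic commutators of weight `n` and by
`γ_{n+1}`. -/
def basicSpan (n : ℕ) : Subgroup G :=
  Subgroup.closure {g | ∃ t, IsBasicCommutator o t ∧ t.length = n ∧ bracketEval x t = g} ⊔ γ n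

theorem basicSpan_le (n : ℕ) : basicSpan o x (n + 1) ≤ γ n := by
  refine sup_le ((Subgroup.closure_le _).2 ?_) (Subgroup.lowerCentralSeries_antitone _ n.le_succ)
  rintro _ ⟨t, -, ht, rfl⟩
  have := bracketEval_mem_lowerCentralSeries x t
  rwa [ht] at this

theorem isCollecting_basicSpan : IsCollecting o x (fun n => (basicSpan o x n : Set G)) where
  basic_mem t ht := Subgroup.mem_sup_left (Subgroup.subset_closure ⟨t, ht, rfl, rfl⟩)
  linear m n v hm hn hv H := by
    obtain ⟨m, rfl⟩ := Nat.exists_eq_succ_of_ne_zero hm.ne'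
    obtain ⟨n, rfl⟩ := Nat.exists_eq_succ_of_ne_zero hn.ne'
    have hv' := basicSpan_le o x n hv
    have hC : γ (m + n + 2) ≤ basicSpan o x (m.succ + n.succ) := by
      rw [show m + n + 2 = m.succ + n.succ by omega]
      exact le_sup_right
    have key : basicSpan o x m.succ ≤ bracketPreimage m n v hv' _ hC := by
      refine sup_le ((Subgroup.closure_le _).2 ?_) fun a ha => ?_
      · rintro _ ⟨t, ht, htl, rfl⟩
        refine ⟨?_, H t ht htl⟩
        have := bracketEval_mem_lowerCentralSeries x t
        rwa [htl] at this
      · refine ⟨mem_lowerCentralSeries_of_le m.le_succ ha, hC ?_⟩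
        refine mem_lowerCentralSeries_of_le ?_ (commutatorElement_mem_lowerCentralSeries ha hv')
        omega
    exact fun a ha => (key ha).2
  self_mem n a := by simp [one_mem]
  anti n a b h := by
    rw [← commutatorElement_inv]
    exact (basicSpan o x n).inv_mem h
  jacobi i j k a b c hi hj hk ha hb hc h₁ h₂ := by
    obtain ⟨i, rfl⟩ := Nat.exists_eq_succ_of_ne_zero hi.ne'
    obtain ⟨j, rfl⟩ := Nat.exists_eq_succ_of_ne_zero hj.ne'
    obtain ⟨k, rfl⟩ := Nat.exists_eq_succ_of_ne_zero hk.ne'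
    refine commutatorElement_jacobi_mem (basicSpan_le o x i ha) (basicSpan_le o x j hb)
      (basicSpan_le o x k hc) ?_ h₁ h₂
    rw [show i + j + k + 3 = i.succ + j.succ + k.succ by omega]
    exact le_sup_right

/-- The group half of the theorem on basic commutators: those of weight `n + 1` generate
`γ_{n+1}` modulo `γ_{n+2}`. -/
theorem lowerCentralSeries_le_basicSpan (hx : Subgroup.closure (Set.range x) = ⊤) (n : ℕ) :
    γ n ≤ basicSpan o x (n + 1) := by
  have h1 : (⊤ : Subgroup G) ≤ basicSpan o x 1 := by
    rw [← hx, Subgroup.closure_le]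
    rintro _ ⟨i, rfl⟩
    exact Subgroup.mem_sup_left (Subgroup.subset_closure ⟨FreeMagma.of i, .letter i, rfl, rfl⟩)
  induction n with
  | zero => exact h1
  | succ n ih =>
    rw [Subgroup.lowerCentralSeries_succ, Subgroup.commutator_le]
    intro a ha b hb
    exact (isCollecting_basicSpan o x).bracket_mem n.succ_pos one_pos (ih ha) (h1 hb)

end LowerCentral

/-! ### Words and nondecreasing sequences of basic commutators -/

section Words

variable {r : ℕ}

/-- The word obtained from a formal commutator by forgetting the brackets. -/
def foliage : FreeMagma (Fin r) → List (Fin r)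
  | .of i => [i]
  | .mul u v => foliage u ++ foliage v

theorem foliage_mul (u v : FreeMagma (Fin r)) : foliage (u * v) = foliage u ++ foliage v := rfl

theorem length_foliage (t : FreeMagma (Fin r)) : (foliage t).length = t.length := by
  induction t with
  | ih1 i => rfl
  | ih2 u v hu hv =>
    rw [foliage_mul, List.length_append, hu, hv]
    rfl

theorem length_flatMap_foliage (l : List (FreeMagma (Fin r))) :
    (l.flatMap foliage).length = (l.map FreeMagma.length).sum := by
  rw [List.length_flatMap]
  simp only [length_foliage]

variable (o : CommutatorOrder r)

/-- A nondecreasing sequence of basic commutators. -/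
def IsStandard (l : List (FreeMagma (Fin r))) : Prop :=
  (∀ t ∈ l, IsBasicCommutator o t) ∧ l.Pairwise (fun a b => ¬ o.lt b a)

open Classical in
/-- Insert a formal commutator at the front of a nondecreasing sequence: as long as it exceeds the
first entry, it is bracketed with it. -/
noncomputable def insertCommutator :
    FreeMagma (Fin r) → List (FreeMagma (Fin r)) → List (FreeMagma (Fin r))
  | u, [] => [u]
  | u, h :: l => if o.lt h u then insertCommutator (u * h) l else u :: h :: l

variable {o}

theorem insertCommutator_cons_of_lt {u h : FreeMagma (Fin r)} {l : List (FreeMagma (Fin r))}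
    (hu : o.lt h u) : insertCommutator o u (h :: l) = insertCommutator o (u * h) l := by
  rw [insertCommutator, if_pos hu]

theorem insertCommutator_eq_cons {u : FreeMagma (Fin r)} {l : List (FreeMagma (Fin r))}
    (hu : ∀ h ∈ l, ¬ o.lt h u) : insertCommutator o u l = u :: l := by
  cases l with
  | nil => rfl
  | cons h l => rw [insertCommutator, if_neg (hu h List.mem_cons_self)]

variable (o)

/-- The sequence of basic commutators obtained from a word by inserting its letters one after
another, from the right to the left, into the empty sequence. It turns the word underlying a
nondecreasing sequence of basic commutators back into that sequence. -/
noncomputable def standardFactorization (w : List (Fin r)) : List (FreeMagma (Fin r)) :=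
  w.foldr (fun i l => insertCommutator o (FreeMagma.of i) l) []

variable {o}

/-- Inserting the letters of a basic commutator one by one amounts to inserting it as a whole. -/
theorem foldr_foliage {u : FreeMagma (Fin r)} (hu : IsBasicCommutator o u) :
    ∀ {l : List (FreeMagma (Fin r))}, IsStandard o l →
      (∀ s t, u = s * t → ∀ h ∈ l, ¬ o.lt h t) →
      (foliage u).foldr (fun i l => insertCommutator o (FreeMagma.of i) l) l =
        insertCommutator o u l := by
  induction hu with
  | letter i => intros; rfl
  | bracket u v hu hv hlt hle ihu ihv =>
    intro l hl hul
    have hvl := hul u v rfl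
    have hstd : IsStandard o (v :: l) := by
      refine ⟨fun t ht => ?_, List.pairwise_cons.2 ⟨hvl, hl.2⟩⟩
      rcases List.mem_cons.1 ht with rfl | ht
      exacts [hv, hl.1 t ht]
    rw [foliage_mul, List.foldr_append, ihv hl, insertCommutator_eq_cons hvl, ihu hstd,
      insertCommutator_cons_of_lt hlt]
    · rintro s t hst h hh
      have := o.not_lt.2 (hle s t hst)
      rcases List.mem_cons.1 hh with rfl | hm
      · exact this
      · intro h1
        rcases hle s t hst with rfl | h2
        · exact hvl h hm h1
        · exact hvl h hm (o.trans h1 h2)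
    · rintro s t rfl h hh h1
      exact hvl h hh (o.trans h1 (o.lt_mul_right s t))

theorem standardFactorization_flatMap_foliage {l : List (FreeMagma (Fin r))}
    (hl : IsStandard o l) : standardFactorization o (l.flatMap foliage) = l := by
  induction l with
  | nil => rfl
  | cons u l ih =>
    have hp := List.pairwise_cons.1 hl.2
    have hl' : IsStandard o l := ⟨fun t ht => hl.1 t (List.mem_cons_of_mem _ ht), hp.2⟩
    rw [standardFactorization, List.flatMap_cons, List.foldr_append]
    change (foliage u).foldr _ (standardFactorization o (l.flatMap foliage)) = _
    rw [ih hl', foldr_foliage (hl.1 u List.mem_cons_self) hl', insertCommutator_eq_cons hp.1]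
    rintro s t rfl h hh h1
    exact hp.1 h hh (o.trans h1 (o.lt_mul_right s t))

theorem standardFactorization_foliage {t : FreeMagma (Fin r)} (ht : IsBasicCommutator o t) :
    standardFactorization o (foliage t) = [t] := by
  have := standardFactorization_flatMap_foliage (o := o) (l := [t])
    ⟨by simpa using ht, List.pairwise_singleton _ _⟩
  simpa using this

end Words

/-! ### Products of basic commutators span an associative algebra -/

section Straightening

variable {r : ℕ} (o : CommutatorOrder r) (S : Type*) [CommRing S] {A : Type*} [Ring A] [Algebra S A]
  (x : Fin r → A)

/-- In an associative algebra, with the commutator bracket, the linear combinations of the basic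
commutators of each weight are closed under brackets. -/
theorem isCollecting_span :
    IsCollecting o x (fun n => (Submodule.span S
      {a | ∃ t, IsBasicCommutator o t ∧ t.length = n ∧ bracketEval x t = a} : Set A)) where
  basic_mem t ht := Submodule.subset_span ⟨t, ht, rfl, rfl⟩
  linear m n v _ _ _ H a ha := by
    rw [SetLike.mem_coe] at ha ⊢
    induction ha using Submodule.span_induction with
    | mem a ha =>
      obtain ⟨t, ht, htl, rfl⟩ := ha
      exact H t ht htl
    | zero => simp [Ring.lie_def]
    | add a b _ _ ha hb =>
      have e : ⁅a + b, v⁆ = ⁅a, v⁆ + ⁅b, v⁆ := by simp only [Ring.lie_def]; noncomm_ring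
      rw [e]
      exact add_mem ha hb
    | smul s a _ ha =>
      have e : ⁅s • a, v⁆ = s • ⁅a, v⁆ := by simp [Ring.lie_def, smul_sub]
      rw [e]
      exact Submodule.smul_mem _ s ha
  self_mem n a := by simp [Ring.lie_def]
  anti n a b h := by
    rw [SetLike.mem_coe] at h ⊢
    have e : ⁅b, a⁆ = -⁅a, b⁆ := by simp [Ring.lie_def]
    rw [e]
    exact neg_mem h
  jacobi i j k a b c _ _ _ _ _ _ h₁ h₂ := by
    rw [SetLike.mem_coe] at h₁ h₂ ⊢
    have e : ⁅⁅a, b⁆, c⁆ = ⁅⁅a, c⁆, b⁆ + ⁅a, ⁅b, c⁆⁆ := by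
      simp only [Ring.lie_def]
      noncomm_ring
    rw [e]
    exact add_mem h₁ h₂

/-- The span of the products of at most `k` basic commutators of total weight `n`. -/
def basicProductSpan (k n : ℕ) : Submodule S A :=
  Submodule.span S {a | ∃ l : List (FreeMagma (Fin r)), (∀ t ∈ l, IsBasicCommutator o t) ∧
    l.length ≤ k ∧ (l.map FreeMagma.length).sum = n ∧ (l.map (bracketEval x)).prod = a}

/-- The span of the nondecreasing products of basic commutators of total weight `n`. -/
def standardSpan (n : ℕ) : Submodule S A :=
  Submodule.span S {a | ∃ l : List (FreeMagma (Fin r)), IsStandard o l ∧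
    (l.map FreeMagma.length).sum = n ∧ (l.map (bracketEval x)).prod = a}

variable {o S x}

theorem mul_mem_basicProductSpan {k n : ℕ} {t : FreeMagma (Fin r)} (ht : IsBasicCommutator o t)
    {a : A} (ha : a ∈ basicProductSpan o S x k n) :
    bracketEval x t * a ∈ basicProductSpan o S x (k + 1) (t.length + n) := by
  induction ha using Submodule.span_induction with
  | mem a ha =>
    obtain ⟨l, hl, hk, hn, rfl⟩ := ha
    refine Submodule.subset_span ⟨t :: l, ?_, ?_, ?_, ?_⟩
    · simpa using ⟨ht, hl⟩
    · simpa using hk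
    · simp [hn]
    · simp
  | zero => simp
  | add a b _ _ ha hb => rw [mul_add]; exact add_mem ha hb
  | smul s a _ ha => rw [mul_smul_comm]; exact Submodule.smul_mem _ s ha

/-- Reordering a product of basic commutators changes it only by products of fewer factors. -/
theorem prod_sub_prod_mem_of_perm {l l' : List (FreeMagma (Fin r))} (h : l.Perm l')
    (hl : ∀ t ∈ l, IsBasicCommutator o t) :
    (l.map (bracketEval x)).prod - (l'.map (bracketEval x)).prod ∈
      basicProductSpan o S x (l.length - 1) (l.map FreeMagma.length).sum := by
  induction h with
  | nil => simp
  | @cons t l l' h ih =>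
    have ht := hl t List.mem_cons_self
    cases l with
    | nil => simp [List.nil_perm.1 h]
    | cons u l =>
      have := mul_mem_basicProductSpan ht (ih fun t ht => hl t (List.mem_cons_of_mem _ ht))
      simpa [mul_sub] using this
  | swap a b l =>
    have hb := hl b (by simp)
    have ha := hl a (by simp)
    have hl' : ∀ t ∈ l, IsBasicCommutator o t := fun t ht => hl t (by simp [ht])
    have hab := (isCollecting_span o S x).bracket_basic_mem _ b a hb ha rfl
    rw [SetLike.mem_coe] at hab
    have e : ((b :: a :: l).map (bracketEval x)).prod - ((a :: b :: l).map (bracketEval x)).prod =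
        ⁅bracketEval x b, bracketEval x a⁆ * (l.map (bracketEval x)).prod := by
      simp [Ring.lie_def, sub_mul, mul_assoc]
    rw [e]
    generalize ⁅bracketEval x b, bracketEval x a⁆ = z at hab
    induction hab using Submodule.span_induction with
    | mem z hz =>
      obtain ⟨t, ht, htl, rfl⟩ := hz
      refine Submodule.subset_span ⟨t :: l, ?_, ?_, ?_, ?_⟩
      · simpa using ⟨ht, hl'⟩
      · simp
      · simp [htl, add_assoc]
      · simp
    | zero => simp
    | add y z _ _ hy hz => rw [add_mul]; exact add_mem hy hz
    | smul s z _ hz => rw [smul_mul_assoc]; exact Submodule.smul_mem _ s hz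
  | @trans l₁ l₂ l₃ h₁ h₂ ih₁ ih₂ =>
    have e1 := ih₁ hl
    have e2 := ih₂ fun t ht => hl t (h₁.mem_iff.2 ht)
    rw [← h₁.length_eq, ← (h₁.map FreeMagma.length).sum_eq] at e2
    simpa using add_mem e1 e2

/-- Straightening: every product of basic commutators is a combination of nondecreasing ones. -/
theorem prod_mem_standardSpan (k : ℕ) : ∀ l : List (FreeMagma (Fin r)),
    (∀ t ∈ l, IsBasicCommutator o t) → l.length ≤ k →
      (l.map (bracketEval x)).prod ∈ standardSpan o S x (l.map FreeMagma.length).sum := by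
  classical
  induction k with
  | zero =>
    intro l _ hk
    rw [List.length_eq_zero_iff.1 (Nat.le_zero.1 hk)]
    exact Submodule.subset_span ⟨[], ⟨by simp, List.Pairwise.nil⟩, rfl, rfl⟩
  | succ k ih =>
    intro l hl hk
    let R : FreeMagma (Fin r) → FreeMagma (Fin r) → Prop := fun a b => ¬ o.lt b a
    have : Std.Total R := ⟨fun a b => by
      by_contra! h
      exact o.irrefl _ (o.trans (not_not.1 h.1) (not_not.1 h.2))⟩
    have : IsTrans _ R := ⟨fun a b c h₁ h₂ h => by
      rcases o.not_lt.1 h₁ with rfl | h₁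
      · exact h₂ h
      · exact h₂ (o.trans h h₁)⟩
    have hperm := (List.perm_insertionSort R l).symm
    have h1 := prod_sub_prod_mem_of_perm (S := S) (x := x) hperm hl
    have h2 : basicProductSpan o S x (l.length - 1) (l.map FreeMagma.length).sum ≤
        standardSpan o S x (l.map FreeMagma.length).sum := by
      refine Submodule.span_le.2 ?_
      rintro _ ⟨l', hl', hk', hn', rfl⟩
      rw [← hn']
      exact ih l' hl' (by omega)
    have h3 : ((l.insertionSort R).map (bracketEval x)).prod ∈
        standardSpan o S x (l.map FreeMagma.length).sum :=
      Submodule.subset_span ⟨l.insertionSort R,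
        ⟨fun t ht => hl t (hperm.mem_iff.2 ht), List.pairwise_insertionSort R l⟩,
        ((hperm.map FreeMagma.length).sum_eq).symm, rfl⟩
    simpa using add_mem (h2 h1) h3

end Straightening

/-! ### Independence of the basic commutators -/

section Independence

variable {r : ℕ} (o : CommutatorOrder r) (S : Type*) [CommRing S]

/-- The letters of the free associative algebra, realized as the algebra of the free monoid. -/
noncomputable def freeLetter (i : Fin r) : MonoidAlgebra S (FreeMonoid (Fin r)) :=
  MonoidAlgebra.of S _ (FreeMonoid.of i)

theorem prod_map_freeLetter (w : List (Fin r)) :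
    (w.map (freeLetter S)).prod = MonoidAlgebra.of S _ (FreeMonoid.ofList w) := by
  induction w with
  | nil => exact (map_one _).symm
  | cons i w ih => rw [List.map_cons, List.prod_cons, ih, freeLetter, ← map_mul]; rfl

/-- The basic commutators of weight `n` are linearly independent in the free associative algebra
over any commutative ring. The endomorphism of the component of degree `n` that sends a word to
the product of its `standardFactorization` has all the nondecreasing products of basic
commutators of total weight `n` in its image, so it is surjective, hence injective; and it sends the foliage of a basic
commutator to that commutator. -/
theorem linearIndependent_bracketEval (n : ℕ) :
    LinearIndependent S (fun t : {t : FreeMagma (Fin r) // IsBasicCommutator o t ∧ t.length = n} =>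
      bracketEval (freeLetter S) t.1) := by
  classical
  let W := {w : List (Fin r) // w.length = n}
  have : Fintype {w : List (Fin r) // w.length = n} :=
    inferInstanceAs (Fintype (List.Vector (Fin r) n))
  let P : FreeMagma (Fin r) → MonoidAlgebra S (FreeMonoid (Fin r)) := bracketEval (freeLetter S)
  let co : MonoidAlgebra S (FreeMonoid (Fin r)) →ₗ[S] (W → S) :=
    LinearMap.pi fun w => (Finsupp.lapply (FreeMonoid.ofList w.1)).comp
      (MonoidAlgebra.coeffLinearEquiv S).toLinearMap
  have hco (w w' : W) : co (MonoidAlgebra.of S _ (FreeMonoid.ofList w.1)) w' =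
      (Pi.single w 1 : W → S) w' := by
    by_cases h : w = w'
    · subst h
      simp [co]
    · have h' : w.1 ≠ w'.1 := fun e => h (Subtype.ext e)
      simp [co, Ne.symm h, h']
  let Φ : (W → S) →ₗ[S] (W → S) :=
    (Pi.basisFun S W).constr S fun w => co (((standardFactorization o w.1).map P).prod)
  have hΦ (w : W) : Φ (Pi.single w 1) = co (((standardFactorization o w.1).map P).prod) := by
    rw [← Pi.basisFun_apply, Module.Basis.constr_basis]
  have hsurj : Function.Surjective Φ := by
    rw [← LinearMap.range_eq_top, ← top_le_iff, ← (Pi.basisFun S W).span_eq, Submodule.span_le]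
    rintro _ ⟨w, rfl⟩
    have hle : standardSpan o S (freeLetter S) n ≤ (LinearMap.range Φ).comap co := by
      refine Submodule.span_le.2 ?_
      rintro _ ⟨l, hl, hn, rfl⟩
      refine ⟨Pi.single (⟨l.flatMap foliage, by rw [length_flatMap_foliage, hn]⟩ : W) 1, ?_⟩
      rw [hΦ, standardFactorization_flatMap_foliage hl]
    have hw : (((w.1.map FreeMagma.of).map P).prod) ∈ standardSpan o S (freeLetter S) n := by
      have := prod_mem_standardSpan (o := o) (S := S) (x := freeLetter S) n
        (w.1.map FreeMagma.of) (fun t ht => ?_) (by simp [w.2])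
      · have hn : ((w.1.map FreeMagma.of).map FreeMagma.length).sum = n := by
          simp [Function.comp_def, w.2]
        rwa [hn] at this
      · obtain ⟨i, -, rfl⟩ := List.mem_map.1 ht
        exact .letter i
    have h2 := hle hw
    have e : (((w.1.map FreeMagma.of).map P).prod) =
        MonoidAlgebra.of S _ (FreeMonoid.ofList w.1) := by
      rw [List.map_map, ← prod_map_freeLetter]
      rfl
    rw [e, Submodule.mem_comap] at h2
    rw [Pi.basisFun_apply, SetLike.mem_coe]
    convert h2 using 1
    ext w'
    exact (hco w w').symm
  have hinj := OrzechProperty.injective_of_surjective_endomorphism Φ hsurj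
  have hind : LinearIndependent S fun w : W => Φ (Pi.single w 1) := by
    have := (Pi.basisFun S W).linearIndependent.map' Φ (LinearMap.ker_eq_bot.2 hinj)
    simpa [Function.comp_def] using this
  let word : {t : FreeMagma (Fin r) // IsBasicCommutator o t ∧ t.length = n} → W :=
    fun t => ⟨foliage t.1, by rw [length_foliage, t.2.2]⟩
  have hword : Function.Injective word := by
    intro s t h
    have h1 := congrArg (fun w : W => standardFactorization o w.1) h
    simp only [word, standardFactorization_foliage s.2.1, standardFactorization_foliage t.2.1] at h1
    exact Subtype.ext (List.singleton_injective h1)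
  refine LinearIndependent.of_comp co ?_
  convert hind.comp word hword using 1
  ext t : 1
  refine Eq.trans ?_ (hΦ (word t)).symm
  simp [word, standardFactorization_foliage t.2.1, P]

end Independence

/-! ### Counting basic commutators -/

section Counting

variable {r : ℕ}

theorem finite_basicCommutators (o : CommutatorOrder r) (w : ℕ) :
    {t : FreeMagma (Fin r) | IsBasicCommutator o t ∧ t.length = w}.Finite :=
  (formalCommutators_finite r w).subset fun _ ht => ht.2.le

/-- The number of basic commutators of weight `w` is the dimension of the component of weight `w` of
the Lie algebra generated by the letters in the free associative algebra; in particular it does not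
depend on the order. -/
theorem basicCommutatorCount_eq_finrank (o : CommutatorOrder r) (w : ℕ) :
    basicCommutatorCount o w = Module.finrank ℚ (Submodule.span ℚ
      {a | ∃ t : FreeMagma (Fin r), t.length = w ∧ bracketEval (freeLetter ℚ) t = a}) := by
  have hfin := finite_basicCommutators o w
  have : Fintype {t : FreeMagma (Fin r) // IsBasicCommutator o t ∧ t.length = w} := hfin.fintype
  have hcard : basicCommutatorCount o w =
      Fintype.card {t : FreeMagma (Fin r) // IsBasicCommutator o t ∧ t.length = w} := by
    rw [← Nat.card_eq_fintype_card, basicCommutatorCount]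
    rfl
  rw [hcard, ← finrank_span_eq_card (linearIndependent_bracketEval o ℚ w)]
  suffices h : Submodule.span ℚ (Set.range fun t :
      {t : FreeMagma (Fin r) // IsBasicCommutator o t ∧ t.length = w} =>
        bracketEval (freeLetter ℚ) t.1) = Submodule.span ℚ
      {a | ∃ t : FreeMagma (Fin r), t.length = w ∧ bracketEval (freeLetter ℚ) t = a} by rw [h]
  refine le_antisymm (Submodule.span_mono ?_) (Submodule.span_le.2 ?_)
  · rintro _ ⟨t, rfl⟩
    exact ⟨t.1, t.2.2, rfl⟩
  · rintro _ ⟨t, rfl, rfl⟩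
    refine Submodule.span_mono ?_ ((isCollecting_span o ℚ (freeLetter ℚ)).bracketEval_mem t)
    rintro _ ⟨u, hu, hul, rfl⟩
    exact ⟨⟨u, hu, hul⟩, rfl⟩

/-- The letters of a formal commutator all lie below `i`. -/
def LettersBelow (i : ℕ) : FreeMagma (Fin r) → Prop
  | .of j => (j : ℕ) < i
  | .mul u v => LettersBelow i u ∧ LettersBelow i v

theorem lettersBelow_of {i : ℕ} {j : Fin r} :
    LettersBelow i (FreeMagma.of j) ↔ (j : ℕ) < i := Iff.rfl

theorem lettersBelow_mul {i : ℕ} {u v : FreeMagma (Fin r)} :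
    LettersBelow i (u * v) ↔ LettersBelow i u ∧ LettersBelow i v := Iff.rfl

theorem LettersBelow.mono {i j : ℕ} (h : i ≤ j) {t : FreeMagma (Fin r)} (ht : LettersBelow i t) :
    LettersBelow j t := by
  induction t with
  | ih1 a => exact lt_of_lt_of_le (lettersBelow_of.1 ht) h
  | ih2 u v hu hv => exact ⟨hu ht.1, hv ht.2⟩

theorem lettersBelow_self (t : FreeMagma (Fin r)) : LettersBelow r t := by
  induction t with
  | ih1 a => exact a.2
  | ih2 u v hu hv => exact ⟨hu, hv⟩

theorem FreeMagma.length_map {α β : Type*} (f : α → β) (t : FreeMagma α) :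
    (FreeMagma.map f t).length = t.length := by
  induction t with
  | ih1 a => rfl
  | ih2 u v hu hv => rw [map_mul]; exact congrArg₂ (· + ·) hu hv

theorem FreeMagma.map_injective {α β : Type*} {f : α → β} (hf : Function.Injective f) :
    Function.Injective (FreeMagma.map f) := by
  intro s t h
  induction s generalizing t with
  | ih1 a =>
    cases t with
    | of b =>
      replace h : FreeMagma.of (f a) = FreeMagma.of (f b) := h
      injection h with h
      exact congrArg _ (hf h)
    | mul u v => cases h
  | ih2 u v hu hv =>
    cases t with
    | of b => cases h
    | mul u' v' =>
      replace h : FreeMagma.mul (FreeMagma.map f u) (FreeMagma.map f v) =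
        FreeMagma.mul (FreeMagma.map f u') (FreeMagma.map f v') := h
      injection h with h1 h2
      exact congrArg₂ (· * ·) (hu h1) (hv h2)

theorem lettersBelow_iff_exists_map {i : ℕ} (hi : i ≤ r) (t : FreeMagma (Fin r)) :
    LettersBelow i t ↔ ∃ s, FreeMagma.map (Fin.castLE hi) s = t := by
  constructor
  · intro h
    induction t with
    | ih1 a => exact ⟨FreeMagma.of ⟨a, h⟩, rfl⟩
    | ih2 u v hu hv =>
      obtain ⟨s, rfl⟩ := hu h.1
      obtain ⟨s', rfl⟩ := hv h.2
      exact ⟨s * s', map_mul _ _ _⟩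
  · rintro ⟨s, rfl⟩
    induction s with
    | ih1 a => exact a.2
    | ih2 u v hu hv => rw [map_mul]; exact ⟨hu, hv⟩

/-- The order induced on the formal commutators in the first `i` letters. -/
def CommutatorOrder.restrict (o : CommutatorOrder r) {i : ℕ} (hi : i ≤ r) : CommutatorOrder i where
  lt u v := o.lt (FreeMagma.map (Fin.castLE hi) u) (FreeMagma.map (Fin.castLE hi) v)
  strictTotal :=
    have := o.strictTotal
    (RelEmbedding.preimage ⟨_, FreeMagma.map_injective (Fin.castLE_injective hi)⟩
      o.lt).isStrictTotalOrder
  letters a b h := o.letters _ _ h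
  weight u v h := o.weight _ _ (by rwa [FreeMagma.length_map, FreeMagma.length_map])

theorem isBasicCommutator_map_iff (o : CommutatorOrder r) {i : ℕ} (hi : i ≤ r)
    (t : FreeMagma (Fin i)) :
    IsBasicCommutator o (FreeMagma.map (Fin.castLE hi) t) ↔
      IsBasicCommutator (o.restrict hi) t := by
  have hinj := FreeMagma.map_injective (Fin.castLE_injective hi)
  induction t with
  | ih1 a => exact ⟨fun _ => .letter a, fun _ => .letter _⟩
  | ih2 u v hu hv =>
    rw [map_mul]
    constructor
    · intro h
      cases h with
      | bracket _ _ hu' hv' hlt hle =>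
        refine .bracket u v (hu.1 hu') (hv.1 hv') hlt ?_
        rintro s t rfl
        exact (hle _ _ (map_mul _ _ _)).imp (fun h => hinj h) id
    · intro h
      cases h with
      | bracket _ _ hu' hv' hlt hle =>
        refine .bracket _ _ (hu.2 hu') (hv.2 hv') hlt fun s t hst => ?_
        cases u with
        | of a => cases hst
        | mul p q =>
          cases hst
          exact (hle p q rfl).imp (fun h => congrArg _ h) id

theorem ncard_lettersBelow (o : CommutatorOrder r) {i : ℕ} (hi : i ≤ r) (o' : CommutatorOrder i)
    (w : ℕ) :
    {t : FreeMagma (Fin r) | (IsBasicCommutator o t ∧ t.length = w) ∧ LettersBelow i t}.ncard =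
      basicCommutatorCount o' w := by
  rw [basicCommutatorCount_eq_finrank o', ← basicCommutatorCount_eq_finrank (o.restrict hi),
    basicCommutatorCount,
    ← Set.ncard_image_of_injective _ (FreeMagma.map_injective (Fin.castLE_injective hi))]
  congr 1
  ext t
  simp only [Set.mem_ofPred_eq, Set.mem_image, lettersBelow_iff_exists_map hi]
  constructor
  · rintro ⟨⟨h1, h2⟩, s, rfl⟩
    exact ⟨s, ⟨(isBasicCommutator_map_iff o hi s).1 h1, by rwa [FreeMagma.length_map] at h2⟩, rfl⟩
  · rintro ⟨s, ⟨h1, h2⟩, rfl⟩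
    exact ⟨⟨(isBasicCommutator_map_iff o hi s).2 h1, by rwa [FreeMagma.length_map]⟩, s, rfl⟩

/-- With a single letter there is no basic commutator of weight at least `2`. -/
theorem not_lettersBelow_one (o : CommutatorOrder r) {t : FreeMagma (Fin r)}
    (ht : IsBasicCommutator o t) (hw : 2 ≤ t.length) : ¬ LettersBelow 1 t := by
  have main : ∀ t, IsBasicCommutator o t → LettersBelow 1 t → t.length = 1 := by
    intro t ht
    induction ht with
    | letter i => intros; rfl
    | bracket u v hu hv hlt hle ihu ihv =>
      intro h
      have h1 := ihu h.1
      have h2 := ihv h.2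
      cases u with
      | mul p q =>
        have := p.length_pos
        have := q.length_pos
        change p.length + q.length = 1 at h1
        omega
      | of a =>
        cases v with
        | mul p q =>
          have := p.length_pos
          have := q.length_pos
          change p.length + q.length = 1 at h2
          omega
        | of b =>
          have ha : (a : ℕ) < 1 := h.1
          have hb : (b : ℕ) < 1 := h.2
          have : a = b := Fin.ext (by omega)
          subst this
          exact absurd hlt (o.irrefl _)
  intro h
  have := main t ht h
  omega

/-- The largest letter of a formal commutator. -/
def maxLetter : FreeMagma (Fin r) → Fin r
  | .of j => j
  | .mul u v => max (maxLetter u) (maxLetter v)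

theorem lettersBelow_iff_maxLetter {i : ℕ} (t : FreeMagma (Fin r)) :
    LettersBelow i t ↔ (maxLetter t : ℕ) < i := by
  induction t with
  | ih1 a => exact Iff.rfl
  | ih2 u v hu hv =>
    rw [lettersBelow_mul, hu, hv]
    change _ ↔ ((max (maxLetter u) (maxLetter v) : Fin r) : ℕ) < i
    rcases le_total (maxLetter u) (maxLetter v) with h | h
    · rw [max_eq_right h]
      have : (maxLetter u : ℕ) ≤ maxLetter v := h
      omega
    · rw [max_eq_left h]
      have : (maxLetter v : ℕ) ≤ maxLetter u := h
      omega

theorem basicCommutatorCount_mono {i j : ℕ} (hij : i ≤ j) (o : CommutatorOrder i)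
    (o' : CommutatorOrder j) (w : ℕ) : basicCommutatorCount o w ≤ basicCommutatorCount o' w := by
  rw [← ncard_lettersBelow o' hij o w]
  exact Set.ncard_le_ncard (fun t ht => ht.1) (finite_basicCommutators o' w)

theorem basicCommutatorCount_one (o : CommutatorOrder 1) {w : ℕ} (hw : 2 ≤ w) :
    basicCommutatorCount o w = 0 := by
  rw [basicCommutatorCount, Set.ncard_eq_zero (finite_basicCommutators o w)]
  ext t
  simp only [Set.mem_ofPred_eq, Set.mem_empty_iff_false, iff_false]
  rintro ⟨ht, hl⟩
  exact not_lettersBelow_one o ht (hl ▸ hw) (lettersBelow_self t)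

/-- The number of basic commutators whose largest letter is a given one. -/
theorem ncard_maxLetter_eq (o : (r : ℕ) → CommutatorOrder r) (w : ℕ) (i : Fin r) :
    {t : FreeMagma (Fin r) | (IsBasicCommutator (o r) t ∧ t.length = w) ∧
      maxLetter t = i}.ncard =
      basicCommutatorCount (o (i + 1)) w - basicCommutatorCount (o i) w := by
  have hi := i.2
  have hsub : {t | (IsBasicCommutator (o r) t ∧ t.length = w) ∧ LettersBelow (i : ℕ) t} ⊆
      {t | (IsBasicCommutator (o r) t ∧ t.length = w) ∧ LettersBelow (i + 1 : ℕ) t} :=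
    fun t ht => ⟨ht.1, ht.2.mono (Nat.le_succ _)⟩
  rw [← ncard_lettersBelow (o r) hi (o (i + 1)) w, ← ncard_lettersBelow (o r) hi.le (o i) w,
    ← Set.ncard_sdiff hsub ((finite_basicCommutators (o r) w).subset fun t ht => ht.1)]
  congr 1
  ext t
  simp only [Set.mem_ofPred_eq, Set.mem_sdiff, lettersBelow_iff_maxLetter, Fin.ext_iff]
  constructor
  · rintro ⟨h1, h2⟩
    exact ⟨⟨h1, by omega⟩, fun h => by omega⟩
  · rintro ⟨⟨h1, h2⟩, h3⟩
    refine ⟨h1, ?_⟩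
    have : ¬ ((maxLetter t : ℕ) < i) := fun h => h3 ⟨h1, h⟩
    omega

end Counting

/-! ### The Magnus embedding and leading coefficients -/

section Magnus

open PowerSeries

variable {A : Type*} [Ring A]

/-- The units of `A⟦X⟧` that are congruent to `1` modulo `X ^ n`. -/
def unitFiltration (A : Type*) [Ring A] (n : ℕ) : Subgroup (A⟦X⟧)ˣ where
  carrier := {u | X ^ n ∣ (u : A⟦X⟧) - 1}
  one_mem' := by simp
  mul_mem' := by
    rintro u v ⟨g, hg⟩ ⟨h, hh⟩
    refine ⟨g * v + h, ?_⟩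
    rw [mul_add, ← hh, ← mul_assoc, ← hg, Units.val_mul]
    noncomm_ring
  inv_mem' := by
    rintro u ⟨g, hg⟩
    refine ⟨-(g * (u⁻¹ : (A⟦X⟧)ˣ)), ?_⟩
    rw [mul_neg, ← mul_assoc, ← hg, sub_mul, Units.mul_inv, one_mul, neg_sub]

theorem mem_unitFiltration {n : ℕ} {u : (A⟦X⟧)ˣ} :
    u ∈ unitFiltration A n ↔ ∃ g : A⟦X⟧, (u : A⟦X⟧) = 1 + X ^ n * g :=
  exists_congr fun _ => sub_eq_iff_eq_add'

theorem coeff_one_add_X_pow_mul {n : ℕ} (hn : 0 < n) (g : A⟦X⟧) :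
    coeff n (1 + X ^ n * g) = constantCoeff g := by
  have h := coeff_X_pow_mul g n 0
  rw [zero_add] at h
  rw [map_add, h, coeff_one, if_neg hn.ne', zero_add, coeff_zero_eq_constantCoeff_apply]

theorem coeff_mul_of_mem_unitFiltration {n : ℕ} (hn : 0 < n) {u v : (A⟦X⟧)ˣ}
    (hu : u ∈ unitFiltration A n) (hv : v ∈ unitFiltration A n) :
    coeff n ((u * v : (A⟦X⟧)ˣ) : A⟦X⟧) = coeff n (u : A⟦X⟧) + coeff n (v : A⟦X⟧) := by
  obtain ⟨g, hg⟩ := mem_unitFiltration.1 hu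
  obtain ⟨h, hh⟩ := mem_unitFiltration.1 hv
  have e : ((u * v : (A⟦X⟧)ˣ) : A⟦X⟧) = 1 + X ^ n * (g + h + X ^ n * (g * h)) := by
    have e1 : X ^ n * g * (X ^ n * h) = X ^ n * (X ^ n * (g * h)) := by
      rw [mul_assoc, ← mul_assoc g, ← X_pow_mul]; simp only [mul_assoc]
    rw [Units.val_mul, hg, hh, mul_add, mul_add, ← e1]
    noncomm_ring
  rw [e, hg, hh]
  simp only [coeff_one_add_X_pow_mul hn]
  simp [zero_pow hn.ne']

/-- The leading coefficient of a commutator of units is the commutator of the leading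
coefficients. -/
theorem commutatorElement_mem_unitFiltration {m n : ℕ} (hm : 0 < m) (hn : 0 < n) {u v : (A⟦X⟧)ˣ}
    (hu : u ∈ unitFiltration A m) (hv : v ∈ unitFiltration A n) :
    ⁅u, v⁆ ∈ unitFiltration A (m + n) ∧
      coeff (m + n) ((⁅u, v⁆ : (A⟦X⟧)ˣ) : A⟦X⟧) =
        ⁅coeff m (u : A⟦X⟧), coeff n (v : A⟦X⟧)⁆ := by
  obtain ⟨g, hg⟩ := mem_unitFiltration.1 hu
  obtain ⟨h, hh⟩ := mem_unitFiltration.1 hv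
  have e1 : ((u * v : (A⟦X⟧)ˣ) : A⟦X⟧) - ((v * u : (A⟦X⟧)ˣ) : A⟦X⟧) =
      X ^ (m + n) * (g * h - h * g) := by
    have h1 : X ^ m * g * (X ^ n * h) = X ^ (m + n) * (g * h) := by
      rw [mul_assoc, ← mul_assoc g, ← X_pow_mul, pow_add]; simp only [mul_assoc]
    have h2 : X ^ n * h * (X ^ m * g) = X ^ (m + n) * (h * g) := by
      rw [mul_assoc, ← mul_assoc h, ← X_pow_mul, add_comm, pow_add]; simp only [mul_assoc]
    rw [Units.val_mul, Units.val_mul, hg, hh, mul_sub, ← h1, ← h2]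
    noncomm_ring
  have e : ((⁅u, v⁆ : (A⟦X⟧)ˣ) : A⟦X⟧) =
      1 + X ^ (m + n) * ((g * h - h * g) * (((v * u)⁻¹ : (A⟦X⟧)ˣ) : A⟦X⟧)) := by
    have e2 : ⁅u, v⁆ = u * v * (v * u)⁻¹ := by rw [commutatorElement_def]; group
    rw [← mul_assoc, ← e1, sub_mul, Units.mul_inv, e2, Units.val_mul (u * v)]
    abel
  refine ⟨mem_unitFiltration.2 ⟨_, e⟩, ?_⟩
  have hc {k : ℕ} (hk : 0 < k) {w : (A⟦X⟧)ˣ} (hw : w ∈ unitFiltration A k) :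
      constantCoeff (w : A⟦X⟧) = 1 := by
    obtain ⟨z, hz⟩ := mem_unitFiltration.1 hw
    simp [hz, zero_pow hk.ne']
  have hc' : constantCoeff (((v * u)⁻¹ : (A⟦X⟧)ˣ) : A⟦X⟧) = 1 := by
    have h1 := congrArg (constantCoeff (R := A)) (Units.mul_inv (v * u))
    rw [Units.val_mul, map_mul, map_mul, hc hn hv, hc hm hu, one_mul, one_mul, map_one] at h1
    exact h1
  rw [e, hg, hh]
  simp only [coeff_one_add_X_pow_mul hm, coeff_one_add_X_pow_mul hn,
    coeff_one_add_X_pow_mul (Nat.add_pos_left hm n), map_mul, map_sub, hc', mul_one, Ring.lie_def]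

/-- The Magnus homomorphism, with `x_j ↦ 1 + a_j X`; the variable `X` keeps track of the degree. -/
noncomputable def magnus {k : ℕ} (a : Fin k → A) : FreeGroup (Fin k) →* (A⟦X⟧)ˣ :=
  FreeGroup.lift fun j =>
    ⟨1 + X * C (a j), invOfUnit (1 + X * C (a j)) 1, mul_invOfUnit _ _ (by simp),
      invOfUnit_mul _ _ (by simp)⟩

variable {k : ℕ} (a : Fin k → A)

theorem magnus_mem_one (g : FreeGroup (Fin k)) : magnus a g ∈ unitFiltration A 1 := by
  induction g using FreeGroup.induction_on with
  | C1 => rw [map_one]; exact one_mem _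
  | of j =>
    refine mem_unitFiltration.2 ⟨C (a j), ?_⟩
    rw [magnus, FreeGroup.lift_apply_of, pow_one]
  | inv_of j h => rw [map_inv]; exact inv_mem h
  | mul g h hg hh => rw [map_mul]; exact mul_mem hg hh

theorem magnus_bracketEval (t : FreeMagma (Fin k)) :
    magnus a (bracketEval FreeGroup.of t) ∈ unitFiltration A t.length ∧
      coeff t.length (magnus a (bracketEval FreeGroup.of t) : A⟦X⟧) = bracketEval a t := by
  induction t with
  | ih1 j =>
    refine ⟨magnus_mem_one a _, ?_⟩
    rw [bracketEval_of, bracketEval_of, magnus, FreeGroup.lift_apply_of]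
    have := coeff_one_add_X_pow_mul (A := A) one_pos (C (a j))
    rw [pow_one] at this
    exact this.trans (by simp)
  | ih2 u v hu hv =>
    have := commutatorElement_mem_unitFiltration u.length_pos v.length_pos hu.1 hv.1
    rw [hu.2, hv.2] at this
    rw [bracketEval_mul, map_commutatorElement]
    exact this

theorem magnus_mem_of_iteratedCommutator {R : Subgroup (FreeGroup (Fin k))} {d : ℕ}
    (hR : ∀ g ∈ R, magnus a g ∈ unitFiltration A (d + 1)) (c : ℕ) :
    ∀ g ∈ iteratedCommutator R c, magnus a g ∈ unitFiltration A (c + d + 1) := by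
  induction c with
  | zero => simpa [iteratedCommutator] using hR
  | succ c ih =>
    change iteratedCommutator R (c + 1) ≤ (unitFiltration A _).comap (magnus a)
    rw [iteratedCommutator, Subgroup.commutator_le]
    intro g hg h _
    rw [Subgroup.mem_comap, map_commutatorElement]
    have := (commutatorElement_mem_unitFiltration (Nat.succ_pos _) one_pos (ih g hg)
      (magnus_mem_one a h)).1
    rwa [show c + 1 + d + 1 = c + d + 1 + 1 by omega]

theorem magnus_mem_of_lowerCentralSeries (c : ℕ) {g : FreeGroup (Fin k)}
    (hg : g ∈ (⊤ : Subgroup (FreeGroup (Fin k))).lowerCentralSeries c) :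
    magnus a g ∈ unitFiltration A (c + 1) := by
  rw [← iteratedCommutator_top] at hg
  exact magnus_mem_of_iteratedCommutator (d := 0) a (fun g _ => magnus_mem_one a g) c g hg

/-- The leading coefficient of the Magnus homomorphism on `γ_{c+1}`. -/
noncomputable def magnusLeading (c : ℕ) :
    (⊤ : Subgroup (FreeGroup (Fin k))).lowerCentralSeries c →* Multiplicative A where
  toFun g := Multiplicative.ofAdd (coeff (c + 1) (magnus a g : A⟦X⟧))
  map_one' := by simp [coeff_one]
  map_mul' g h := by
    rw [← ofAdd_add, ← coeff_mul_of_mem_unitFiltration c.succ_pos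
      (magnus_mem_of_lowerCentralSeries a c g.2) (magnus_mem_of_lowerCentralSeries a c h.2),
      ← map_mul, Subgroup.coe_mul]

/-- If `R` is trivial to first order under the Magnus homomorphism, then the elements of `[R, _c F]`
have no term of degree `c + 1`. -/
theorem magnusLeading_eq_one {R : Subgroup (FreeGroup (Fin k))}
    (hR : ∀ g ∈ R, coeff 1 (magnus a g : A⟦X⟧) = 0) {c : ℕ}
    (g : (⊤ : Subgroup (FreeGroup (Fin k))).lowerCentralSeries c)
    (hg : (g : FreeGroup (Fin k)) ∈ iteratedCommutator R c) : magnusLeading a c g = 1 := by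
  have h1 : ∀ g ∈ R, magnus a g ∈ unitFiltration A (1 + 1) := by
    intro g hg
    refine X_pow_dvd_iff.2 fun m hm => ?_
    have h0 := X_pow_dvd_iff.1 (magnus_mem_one a g)
    interval_cases m
    · exact h0 0 one_pos
    · rw [map_sub, hR g hg, coeff_one]
      simp
  obtain ⟨z, hz⟩ := mem_unitFiltration.1 (magnus_mem_of_iteratedCommutator a h1 c g hg)
  change Multiplicative.ofAdd (coeff (c + 1) (magnus a g : A⟦X⟧)) = 1
  rw [hz, ← ofAdd_zero, map_add, coeff_X_pow_mul', coeff_one]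
  simp

end Magnus

theorem bracketEval_eq_zero {k : ℕ} {A : Type*} [Ring A] {x : Fin k → A} {i : ℕ}
    (hx : ∀ j : Fin k, i ≤ (j : ℕ) → x j = 0) {t : FreeMagma (Fin k)} (ht : ¬ LettersBelow i t) :
    bracketEval x t = 0 := by
  induction t with
  | ih1 j => exact hx j (not_lt.1 ht)
  | ih2 u v hu hv =>
    rw [lettersBelow_mul, not_and_or] at ht
    rw [bracketEval_mul, Ring.lie_def]
    rcases ht with h | h
    · simp [hu h]
    · simp [hv h]

theorem bracketEval_congr {k : ℕ} {E : Type*} [Bracket E E] {x y : Fin k → E} {i : ℕ}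
    (hxy : ∀ j : Fin k, (j : ℕ) < i → x j = y j) {t : FreeMagma (Fin k)} (ht : LettersBelow i t) :
    bracketEval x t = bracketEval y t := by
  induction t with
  | ih1 j => exact hxy j ht
  | ih2 u v hu hv => rw [bracketEval_mul, bracketEval_mul, hu ht.1, hv ht.2]

/-! ### The multiplier of a finite abelian group -/

/-- A commutative group generated by finitely many elements `e t`, with `e t` of order dividing
`N t` and no relations but those this forces, is a direct product of cyclic groups. -/
theorem nonempty_mulEquiv_pi_zmod {M T : Type*} [CommGroup M] [Fintype T] (e : T → M) (N : T → ℕ)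
    (hgen : Subgroup.closure (Set.range e) = ⊤) (hord : ∀ t, e t ^ N t = 1)
    (hrel : ∀ a : T → ℤ, ∏ t, e t ^ a t = 1 → ∀ t, (N t : ℤ) ∣ a t) :
    Nonempty (M ≃* Multiplicative ((t : T) → ZMod (N t))) := by
  classical
  let φ : Multiplicative (T → ℤ) →* M :=
    { toFun := fun a => ∏ t, e t ^ (a.toAdd t)
      map_one' := by simp
      map_mul' := fun a b => by simp [zpow_add, Finset.prod_mul_distrib] }
  let q : Multiplicative (T → ℤ) →* Multiplicative ((t : T) → ZMod (N t)) :=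
    { toFun := fun a => Multiplicative.ofAdd fun t => (a.toAdd t : ZMod (N t))
      map_one' := by
        rw [← ofAdd_zero]
        congr 1
        ext t
        simp
      map_mul' := fun a b => by
        rw [← ofAdd_add]
        congr 1
        ext t
        simp }
  have hφ : Function.Surjective φ := by
    rw [← MonoidHom.range_eq_top, ← top_le_iff, ← hgen, Subgroup.closure_le]
    rintro _ ⟨t, rfl⟩
    refine ⟨Multiplicative.ofAdd (Pi.single t 1), ?_⟩
    change ∏ s, e s ^ ((Pi.single t 1 : T → ℤ) s) = e t
    rw [Finset.prod_eq_single t (fun s _ hs => by simp [hs]) (by simp)]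
    simp
  have hq : Function.Surjective q := fun a =>
    ⟨Multiplicative.ofAdd fun t => (ZMod.intCast_surjective (a.toAdd t)).choose,
      funext fun t => (ZMod.intCast_surjective (a.toAdd t)).choose_spec⟩
  have hker : φ.ker = q.ker := by
    have hq' (a : Multiplicative (T → ℤ)) : a ∈ q.ker ↔ ∀ t, (N t : ℤ) ∣ a.toAdd t := by
      simp only [← ZMod.intCast_zmod_eq_zero_iff_dvd]
      exact funext_iff
    ext a
    rw [hq']
    refine ⟨fun h => hrel _ h, fun h => Finset.prod_eq_one fun t _ => ?_⟩
    obtain ⟨m, hm⟩ := h t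
    rw [hm, zpow_mul, zpow_natCast, hord, one_zpow]
  exact ⟨((QuotientGroup.quotientKerEquivOfSurjective φ hφ).symm.trans
    (QuotientGroup.quotientMulEquivOfEq hker)).trans
      (QuotientGroup.quotientKerEquivOfSurjective q hq)⟩

/-- Powers come out of the left entry of a commutator, up to deeper terms. -/
theorem commutatorElement_pow_left_eq {G : Type*} [Group G] {m n : ℕ} {u v : G}
    (hu : u ∈ (⊤ : Subgroup G).lowerCentralSeries m)
    (hv : v ∈ (⊤ : Subgroup G).lowerCentralSeries n) (l : ℕ) :
    ∃ z ∈ (⊤ : Subgroup G).lowerCentralSeries (m + n + 2), ⁅u ^ l, v⁆ = z * ⁅u, v⁆ ^ l := by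
  induction l with
  | zero => exact ⟨1, one_mem _, by simp⟩
  | succ l ih =>
    obtain ⟨z, hz, h⟩ := ih
    refine ⟨⁅u, ⁅u ^ l, v⁆⁆ * z, mul_mem (mem_lowerCentralSeries_of_le ?_
      (commutatorElement_mem_lowerCentralSeries hu
        (commutatorElement_mem_lowerCentralSeries (pow_mem hu l) hv))) hz, ?_⟩
    · omega
    · have e : ⁅u * u ^ l, v⁆ = ⁅u, ⁅u ^ l, v⁆⁆ * ⁅u ^ l, v⁆ * ⁅u, v⁆ := by
        simp [commutatorElement_def, mul_assoc]
      rw [pow_succ', e, pow_succ]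
      nth_rewrite 2 [h]
      simp only [mul_assoc]

theorem commutatorElement_pow_mem {G : Type*} [Group G] {R : Subgroup G} [R.Normal]
    (hR : _root_.commutator G ≤ R) {m n l : ℕ} {u v : G}
    (hu : u ∈ (⊤ : Subgroup G).lowerCentralSeries m)
    (hv : v ∈ (⊤ : Subgroup G).lowerCentralSeries n) (hul : u ^ l ∈ iteratedCommutator R m) :
    ⁅u, v⁆ ^ l ∈ iteratedCommutator R (m + n + 1) := by
  obtain ⟨z, hz, h⟩ := commutatorElement_pow_left_eq hu hv l
  rw [← Subgroup.mul_mem_cancel_left _ (lowerCentralSeries_le_iteratedCommutator R hR _ hz), ← h]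
  refine lowerCentralSeries_commutator_iteratedCommutator_le R n m ?_
  rw [Subgroup.commutator_comm]
  exact Subgroup.commutator_mem_commutator hul hv

/-- If a power of the largest letter of `t` lies in `R`, then so does, up to deeper terms, the same
power of the commutator `t`: by multilinearity the power can be moved to that letter. -/
theorem bracketEval_pow_mem {G : Type*} [Group G] {R : Subgroup G} [R.Normal]
    (hR : _root_.commutator G ≤ R) {k : ℕ} (x : Fin k → G) {l : ℕ} (t : FreeMagma (Fin k))
    (hx : x (maxLetter t) ^ l ∈ R) :
    bracketEval x t ^ l ∈ iteratedCommutator R (t.length - 1) := by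
  induction t with
  | ih1 j => exact hx
  | ih2 u v hu hv =>
    have h1 := u.length_pos
    have h2 := v.length_pos
    have hu' := bracketEval_mem_lowerCentralSeries x u
    have hv' := bracketEval_mem_lowerCentralSeries x v
    have hmax : maxLetter (u * v) = max (maxLetter u) (maxLetter v) := rfl
    have hlen : (u * v).length - 1 = u.length - 1 + (v.length - 1) + 1 := by
      change u.length + v.length - 1 = _
      omega
    rw [bracketEval_mul, hlen]
    rcases max_choice (maxLetter u) (maxLetter v) with h | h
    · exact commutatorElement_pow_mem hR hu' hv' (hu (by rwa [hmax, h] at hx))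
    · rw [← commutatorElement_inv, inv_pow, add_comm (u.length - 1)]
      exact inv_mem (commutatorElement_pow_mem hR hv' hu' (hv (by rwa [hmax, h] at hx)))

section Multiplier

variable {k : ℕ}

/-- To first order the Magnus homomorphism is the linear extension of `a`. -/
theorem ofAdd_coeff_one_magnus {A : Type*} [Ring A] (a : Fin k → A) (g : FreeGroup (Fin k)) :
    Multiplicative.ofAdd (PowerSeries.coeff 1 (magnus a g : PowerSeries A)) =
      FreeGroup.lift (fun j => Multiplicative.ofAdd (a j)) g := by
  let f : FreeGroup (Fin k) →* Multiplicative A :=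
    { toFun := fun g => Multiplicative.ofAdd (PowerSeries.coeff 1 (magnus a g : PowerSeries A))
      map_one' := by simp [PowerSeries.coeff_one]
      map_mul' := fun g h => by
        rw [← ofAdd_add, ← coeff_mul_of_mem_unitFiltration one_pos (magnus_mem_one a g)
          (magnus_mem_one a h), ← map_mul] }
  refine DFunLike.congr_fun (f := f) (FreeGroup.ext_hom _ _ fun j => ?_) g
  rw [FreeGroup.lift_apply_of]
  exact congrArg Multiplicative.ofAdd (magnus_bracketEval a (FreeMagma.of j)).2

/-- The letters up to `i` of the free associative algebra over `ℤ/N`, the others being set to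
zero. -/
noncomputable def truncatedLetter (N : ℕ) (i j : Fin k) :
    MonoidAlgebra (ZMod N) (FreeMonoid (Fin k)) :=
  if j ≤ i then freeLetter (ZMod N) j else 0

/-- The multiplier of an abelian group on `k` generators whose relations contain the powers
`x_j ^ N j` and are trivial, to first order, under the homomorphisms to the free algebras over
`ZMod (N i)` in the first letters, up to `x_i`. The basic commutators are indexed by an auxiliary
type `T`, and `N'` is the annihilator, read off from the largest letter. -/
theorem HigherSchurMultiplier.nonempty_mulEquiv_pi_zmod (R : Subgroup (FreeGroup (Fin k)))
    [R.Normal] (N : Fin k → ℕ) (hR : _root_.commutator _ ≤ R)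
    (hpow : ∀ j, FreeGroup.of j ^ N j ∈ R)
    (hlin : ∀ i, ∀ g ∈ R,
      FreeGroup.lift (fun j => Multiplicative.ofAdd (truncatedLetter (N i) i j)) g = 1)
    {c : ℕ} (hc : 1 ≤ c) (o : CommutatorOrder k) {T : Type*} [Fintype T]
    (e : T ≃ {t : FreeMagma (Fin k) // IsBasicCommutator o t ∧ t.length = c + 1}) (N' : T → ℕ)
    (hN' : ∀ p, N' p = N (maxLetter (e p).1)) :
    Nonempty (HigherSchurMultiplier R c ≃* Multiplicative ((p : T) → ZMod (N' p))) := by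
  classical
  have hle : (⊤ : Subgroup (FreeGroup (Fin k))).lowerCentralSeries c ≤ R :=
    (Subgroup.lowerCentralSeries_antitone _ hc).trans
      (by rwa [Subgroup.top_lowerCentralSeries_one])
  have hnext : (⊤ : Subgroup (FreeGroup (Fin k))).lowerCentralSeries (c + 1) ≤
      iteratedCommutator R c := lowerCentralSeries_le_iteratedCommutator R hR c
  have hmemK (g : ↥(R ⊓ (⊤ : Subgroup (FreeGroup (Fin k))).lowerCentralSeries c))
      (hg : (g : FreeGroup (Fin k)) ∈ iteratedCommutator R c) :
      (QuotientGroup.mk g : HigherSchurMultiplier R c) = 1 :=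
    (QuotientGroup.eq_one_iff _).2 hg
  let : CommGroup (HigherSchurMultiplier R c) :=
    { (inferInstance : Group (HigherSchurMultiplier R c)) with
      mul_comm := by
        intro a b
        induction a using QuotientGroup.induction_on with | H a
        induction b using QuotientGroup.induction_on with | H b
        rw [← commutatorElement_eq_one_iff_mul_comm]
        refine hmemK ⁅a, b⁆ (hnext (mem_lowerCentralSeries_of_le ?_
          (commutatorElement_mem_lowerCentralSeries a.2.2 b.2.2)))
        omega }
  have hmem (p : T) : bracketEval FreeGroup.of (e p).1 ∈
      R ⊓ (⊤ : Subgroup (FreeGroup (Fin k))).lowerCentralSeries c := by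
    have := bracketEval_mem_lowerCentralSeries FreeGroup.of (e p).1
    rw [(e p).2.2] at this
    exact ⟨hle this, this⟩
  let E : T → HigherSchurMultiplier R c := fun p => QuotientGroup.mk ⟨_, hmem p⟩
  refine _root_.nonempty_mulEquiv_pi_zmod E N' ?_ ?_ ?_
  · rw [← top_le_iff]
    rintro a -
    induction a using QuotientGroup.induction_on with | H a
    obtain ⟨g, hgR, hg⟩ := a
    have hle2 : basicSpan o FreeGroup.of (c + 1) ≤
        ((Subgroup.closure (Set.range E)).comap (QuotientGroup.mk' _)).map
          (Subgroup.subtype (R ⊓ (⊤ : Subgroup (FreeGroup (Fin k))).lowerCentralSeries c)) := by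
      refine sup_le ((Subgroup.closure_le _).2 ?_) fun g hg => ?_
      · rintro _ ⟨t, ht, hl, rfl⟩
        refine ⟨⟨_, hmem (e.symm ⟨t, ht, hl⟩)⟩,
          Subgroup.subset_closure ⟨e.symm ⟨t, ht, hl⟩, rfl⟩, ?_⟩
        simp
      · have hg' := mem_lowerCentralSeries_of_le c.le_succ hg
        have h1 := hmemK ⟨g, hle hg', hg'⟩ (hnext hg)
        refine ⟨⟨g, hle hg', hg'⟩, Subgroup.mem_comap.2 ?_, rfl⟩
        exact (congrArg (· ∈ Subgroup.closure (Set.range E)) h1).mpr (one_mem _)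
    obtain ⟨g', hg', rfl⟩ := hle2
      (lowerCentralSeries_le_basicSpan o _ (FreeGroup.closure_range_of _) c hg)
    exact hg'
  · intro p
    refine hmemK (⟨_, hmem p⟩ ^ N' p) ?_
    have := bracketEval_pow_mem hR FreeGroup.of (e p).1 (l := N' p) (by rw [hN']; exact hpow _)
    rwa [(e p).2.2] at this
  · intro a ha p
    set i := maxLetter (e p).1 with hi
    -- The homomorphism that detects the commutators whose largest letter is `i`.
    let ψ : HigherSchurMultiplier R c →*
        Multiplicative (MonoidAlgebra (ZMod (N i)) (FreeMonoid (Fin k))) :=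
      QuotientGroup.lift _
        ((magnusLeading (truncatedLetter (N i) i) c).comp (Subgroup.inclusion inf_le_right))
        fun g hg => magnusLeading_eq_one _ (fun g hg => by
          have := (ofAdd_coeff_one_magnus _ g).trans (hlin i g hg)
          exact ofAdd_eq_one.1 this) _ hg
    have hψ (s : T) : ψ (E s) =
        Multiplicative.ofAdd (bracketEval (truncatedLetter (N i) i) (e s).1) := by
      have := (magnus_bracketEval (truncatedLetter (N i) i) (e s).1).2
      rw [(e s).2.2] at this
      exact congrArg Multiplicative.ofAdd this
    have h1 : ∑ s, a s • bracketEval (truncatedLetter (N i) i) (e s).1 = 0 := by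
      have := congrArg ψ ha
      rw [map_prod, map_one] at this
      simp only [map_zpow, hψ, ← ofAdd_zsmul] at this
      rwa [← ofAdd_sum, ofAdd_eq_one] at this
    have hlt (j : Fin k) : j ≤ i ↔ (j : ℕ) < i + 1 := Nat.lt_succ_iff.symm
    have h2 : ∑ s, (if LettersBelow (i + 1) (e s).1 then (a s : ZMod (N i)) else 0) •
        bracketEval (freeLetter (ZMod (N i))) (e s).1 = 0 := by
      rw [← h1]
      refine Finset.sum_congr rfl fun s _ => ?_
      split_ifs with h
      · rw [Int.cast_smul_eq_zsmul, bracketEval_congr (fun j hj => ?_) h]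
        rw [truncatedLetter, if_pos ((hlt j).2 hj)]
      · rw [zero_smul, bracketEval_eq_zero (i := i + 1) (fun j hj => ?_) h, smul_zero]
        rw [truncatedLetter, if_neg]
        rw [hlt]
        omega
    have hind := (linearIndependent_bracketEval o (ZMod (N i)) (c + 1)).comp e e.injective
    have h3 := Fintype.linearIndependent_iff.1 hind _ h2 p
    rw [if_pos ((lettersBelow_iff_maxLetter _).2 (Nat.lt_succ_self _))] at h3
    rw [hN', ← ZMod.intCast_zmod_eq_zero_iff_dvd]
    exact h3

/-- The standard presentation of `⨁ ZMod (n i)`. -/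
def standardPresentation (k : ℕ) (n : ℕ → ℕ) :
    FreeGroup (Fin k) →* Multiplicative ((i : Finset.Icc 1 k) → ZMod (n i)) :=
  FreeGroup.lift fun j => Multiplicative.ofAdd
    (Pi.single ⟨(j : ℕ) + 1, Finset.mem_Icc.2 ⟨by omega, j.2⟩⟩ 1)

theorem standardPresentation_surjective (n : ℕ → ℕ) :
    Function.Surjective (standardPresentation k n) := by
  intro f
  change f ∈ (standardPresentation k n).range
  have hf : f = ∏ i, Multiplicative.ofAdd (Pi.single i (f.toAdd i)) := by
    rw [← ofAdd_sum, Finset.univ_sum_single]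
    rfl
  rw [hf]
  refine Subgroup.prod_mem _ fun i _ => ?_
  obtain ⟨j, rfl⟩ : ∃ j : Fin k,
      (⟨(j : ℕ) + 1, Finset.mem_Icc.2 ⟨by omega, j.2⟩⟩ : Finset.Icc 1 k) = i := by
    have hi := Finset.mem_Icc.1 i.2
    exact ⟨⟨(i : ℕ) - 1, by omega⟩, Subtype.ext (Nat.sub_add_cancel hi.1)⟩
  obtain ⟨m, hm⟩ := ZMod.intCast_surjective (f.toAdd _)
  refine ⟨FreeGroup.of j ^ m, ?_⟩
  rw [map_zpow, standardPresentation, FreeGroup.lift_apply_of, ← ofAdd_zsmul, ← Pi.single_smul,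
    zsmul_one, hm]

/-- A family `a` whose `j`-th member is annihilated by `n (j + 1)` defines a homomorphism on the
free group that factors through `⨁ ZMod (n i)`. -/
theorem lift_eq_one_of_mem_ker (n : ℕ → ℕ) {B : Type*} [AddCommGroup B] (a : Fin k → B)
    (ha : ∀ j : Fin k, (n (j + 1) : ℤ) • a j = 0) {g : FreeGroup (Fin k)}
    (hg : g ∈ (standardPresentation k n).ker) :
    FreeGroup.lift (fun j => Multiplicative.ofAdd (a j)) g = 1 := by
  let χ : ((i : Finset.Icc 1 k) → ZMod (n i)) →+ B :=
    ∑ j : Fin k, (ZMod.lift (n (j + 1)) ⟨zmultiplesHom B (a j), ha j⟩).comp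
      (Pi.evalAddMonoidHom (fun i : Finset.Icc 1 k => ZMod (n i))
        ⟨(j : ℕ) + 1, Finset.mem_Icc.2 ⟨by omega, j.2⟩⟩)
  have h : FreeGroup.lift (fun j => Multiplicative.ofAdd (a j)) =
      (AddMonoidHom.toMultiplicative χ).comp (standardPresentation k n) := by
    refine FreeGroup.ext_hom _ _ fun j => ?_
    rw [MonoidHom.comp_apply, standardPresentation, FreeGroup.lift_apply_of,
      FreeGroup.lift_apply_of]
    refine congrArg Multiplicative.ofAdd (?_ : a j = χ (Pi.single _ 1))
    rw [AddMonoidHom.finsetSum_apply, Finset.sum_eq_single j]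
    · rw [AddMonoidHom.comp_apply, Pi.evalAddMonoidHom_apply, Pi.single_eq_same,
        ← Int.cast_one, ZMod.lift_coe]
      exact (one_zsmul _).symm
    · intro l _ hl
      have hne : (⟨(l : ℕ) + 1, Finset.mem_Icc.2 ⟨by omega, l.2⟩⟩ : Finset.Icc 1 k) ≠
          ⟨(j : ℕ) + 1, Finset.mem_Icc.2 ⟨by omega, j.2⟩⟩ := by
        simpa [Fin.ext_iff] using hl
      simp [Pi.single_eq_of_ne hne]
    · simp
  rw [h, MonoidHom.comp_apply, MonoidHom.mem_ker.1 hg, map_one]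

end Multiplier

theorem theorem2p4 {F : Type*} [Group F] [IsFreeGroup F]
    (k : ℕ) (n : ℕ → ℕ)
    (hpos : ∀ i ∈ Finset.Icc 1 k, 0 < n i)
    (hdvd : ∀ i : ℕ, 1 ≤ i → i + 1 ≤ k → n (i + 1) ∣ n i)
    (π : F →* Multiplicative ((i : Finset.Icc 1 k) → ZMod (n i)))
    (hπ : Function.Surjective π)
    (c : ℕ) (hc : 1 ≤ c)
    (o : (r : ℕ) → CommutatorOrder r)
    (b : ℕ → ℕ) (hb : ∀ r : ℕ, b r = basicCommutatorCount (o r) (c + 1)) :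
    (∀ i ∈ Finset.Icc 3 k, b (i - 1) ≤ b i) ∧
    Nonempty (HigherSchurMultiplier π.ker c ≃*
      Multiplicative ((i : Finset.Icc 2 k) →
        Fin (if (i : ℕ) = 2 then b 2 else b i - b (i - 1)) → ZMod (n i))) := by
  classical
  refine ⟨fun i _ => by rw [hb, hb]; exact basicCommutatorCount_mono (Nat.sub_le _ _) _ _ _, ?_⟩
  -- The letters are numbered from `0`, the summands from `1`: `x_j` has order `n (j + 1)`.
  obtain ⟨E₁⟩ := HigherSchurMultiplier.nonempty_mulEquiv π (standardPresentation k n) hπ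
    (standardPresentation_surjective n) c
  let T := {t : FreeMagma (Fin k) // IsBasicCommutator (o k) t ∧ t.length = c + 1}
  have : Finite T := finite_basicCommutators (o k) (c + 1)
  let f : T → Finset.Icc 2 k := fun t => ⟨maxLetter t.1 + 1, by
    have h := not_lettersBelow_one (o k) t.2.1 (by have := t.2.2; omega)
    rw [lettersBelow_iff_maxLetter] at h
    exact Finset.mem_Icc.2 ⟨by omega, (maxLetter t.1).2⟩⟩
  have hcard (i : Finset.Icc 2 k) : Nat.card {t : T // f t = i} =
      if (i : ℕ) = 2 then b 2 else b i - b (i - 1) := by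
    have hi := Finset.mem_Icc.1 i.2
    have h1 := ncard_maxLetter_eq o (c + 1) (⟨(i : ℕ) - 1, by omega⟩ : Fin k)
    have h2 : (i : ℕ) - 1 + 1 = i := by omega
    simp only [h2, ← hb] at h1
    have h3 : (if (i : ℕ) = 2 then b 2 else b i - b (i - 1)) = b i - b (i - 1) := by
      split_ifs with h
      · have hb1 : b 1 = 0 := by rw [hb, basicCommutatorCount_one _ (by omega)]
        rw [h, hb1, Nat.sub_zero]
      · rfl
    rw [h3, ← h1, ← Nat.card_coe_set_eq]
    refine Nat.card_congr ⟨fun t => ⟨t.1.1, t.1.2, ?_⟩, fun t => ⟨⟨t.1, t.2.1⟩, ?_⟩,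
      fun _ => rfl, fun _ => rfl⟩
    · have := congrArg Subtype.val t.2
      simp only [f] at this
      exact Fin.ext (by simp; omega)
    · have := congrArg Fin.val t.2.2
      simp only at this
      exact Subtype.ext (by simp [f]; omega)
  let e : (Σ i : Finset.Icc 2 k, Fin (if (i : ℕ) = 2 then b 2 else b i - b (i - 1))) ≃ T :=
    (Equiv.sigmaCongrRight fun i => (Finite.equivFinOfCardEq (hcard i)).symm).trans
      (Equiv.sigmaFiberEquiv f)
  have he (p) : maxLetter (e p).1 + 1 = (p.1 : ℕ) :=
    congrArg Subtype.val ((Finite.equivFinOfCardEq (hcard p.1)).symm p.2).2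
  have hdvd' (i j : ℕ) (hij : i ≤ j) (hj : j < k) : n (j + 1) ∣ n (i + 1) := by
    induction j, hij using Nat.le_induction with
    | base => exact dvd_rfl
    | succ j hij ih => exact (hdvd (j + 1) (by omega) (by omega)).trans (ih (by omega))
  obtain ⟨E₂⟩ := HigherSchurMultiplier.nonempty_mulEquiv_pi_zmod (standardPresentation k n).ker
    (fun j => n (j + 1)) (Abelianization.commutator_subset_ker _) (fun j => by
      rw [MonoidHom.mem_ker, map_pow, standardPresentation, FreeGroup.lift_apply_of,
        ← ofAdd_nsmul, ← Pi.single_smul]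
      simp) (fun i g hg => lift_eq_one_of_mem_ker n _ (fun j => by
        rw [truncatedLetter]
        split_ifs with h
        · rw [← Int.cast_smul_eq_zsmul (ZMod (n (i + 1))), Int.cast_natCast,
            (ZMod.natCast_eq_zero_iff _ _).2 (hdvd' j i h i.2), zero_smul]
        · exact smul_zero _) hg) hc (o k) e (fun p => n p.1) (fun p => by rw [he])
  exact ⟨(E₁.trans E₂).trans (AddEquiv.toMultiplicative
    { Equiv.piCurry (fun (i : Finset.Icc 2 k)
        (_ : Fin (if (i : ℕ) = 2 then b 2 else b i - b (i - 1))) => ZMod (n i)) with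
      map_add' := fun _ _ => rfl })⟩
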